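/- Let $F$ be a field of characteristic $0$, let $E$ be a vector space over $F$ (possibly infinite-dimensional) with $\dim E\ge 2$, equipped with a nondegenerate symmetric bilinear form $\langle\cdot,\cdot\rangle$, and let $\alpha\in F\setminus\{-1,0,1/2,1,2\}$. Put $t=\dfrac{\alpha^2-1}{\alpha(\alpha-2)}$ and let $S(\alpha,E)=Fz_1\oplus Fz_2\oplus E$ be the commutative nonassociative $F$-algebra with bilinear product $$z_1^2=z_1,\quad z_2^2=z_2,\quad z_1z_2=0,\quad ez_1=\alpha e,\quad ez_2=(1-\alpha)e,\quad ef=\langle e,f\rangle(z_1+tz_2)\qquad(e,f\in E)$$ (the split spin factor algebra). Then every polynomial identity of $S(\alpha,E)$ of degree at most $5$ is a consequence of commutativity and the three associators identity $$((a,b,c),d,b)+((c,b,d),a,b)+((d,b,a),c,b)=0,\qquad (x,y,z)=(xy)z-x(yz).$$ That is, if $f$ is an element of degree at most $5$ of the free nonassociative $F$-algebra on countably many variables that vanishes under all substitutions of elements of $S(\alpha,E)$ for the variables, then $f$ lies in the T-ideal (the two-sided ideal stable under all algebra endomorphisms) generated by $xy-yx$ and $((a,b,c),d,b)+((c,b,d),a,b)+((d,b,a),c,b)$.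 -/

import Mathlib

/-! Polynomial identities of (not necessarily associative or unital) algebras over a field. -/

namespace PolyIdentity

/-- Nonassociative, noncommutative polynomials without constant term over `F` in the countably many
variables `x₀, x₁, x₂, …`. -/
abbrev NAPoly (F : Type*) [Field F] : Type _ := FreeNonUnitalNonAssocAlgebra F ℕ

/-- The variable `xᵢ`. -/
noncomputable abbrev var (F : Type*) [Field F] (i : ℕ) : NAPoly F :=
  FreeNonUnitalNonAssocAlgebra.of F i

/-- `f` has degree at most `n`: every monomial occurring in `f` is a product of at most `n`
variables, counted with multiplicity. -/
def DegreeLE {F : Type*} [Field F] (f : NAPoly F) (n : ℕ) : Prop :=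
  ∀ m ∈ f.coeff.support, m.length ≤ n

/-- `f = 0` is an identity of the `F`-algebra `A`: `f` vanishes under every substitution of elements
of `A` for the variables. -/
def IsIdentityOf {F : Type*} [Field F] (f : NAPoly F) (A : Type*) [NonUnitalNonAssocSemiring A]
    [Module F A] [IsScalarTower F A A] [SMulCommClass F A A] : Prop :=
  ∀ x : ℕ → A, FreeNonUnitalNonAssocAlgebra.lift F x f = 0

/-- A T-ideal: a two-sided ideal of the free algebra (as an `F`-algebra) that is stable under all
algebra endomorphisms, i.e. under all substitutions of polynomials for the variables. -/
structure IsTIdeal {F : Type*} [Field F] (I : Submodule F (NAPoly F)) : Prop where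
  mul_mem_left : ∀ f g : NAPoly F, g ∈ I → f * g ∈ I
  mul_mem_right : ∀ f g : NAPoly F, f ∈ I → f * g ∈ I
  map_mem : ∀ (φ : NAPoly F →ₙₐ[F] NAPoly F) (f : NAPoly F), f ∈ I → φ f ∈ I

/-- The T-ideal generated by a set of polynomials. -/
noncomputable def tIdeal {F : Type*} [Field F] (S : Set (NAPoly F)) : Submodule F (NAPoly F) :=
  sInf {I | IsTIdeal I ∧ S ⊆ I}

/-- The identity `f = 0` is a consequence of the identities `g = 0`, `g ∈ S`. -/
def IsConsequenceOf {F : Type*} [Field F] (f : NAPoly F) (S : Set (NAPoly F)) : Prop :=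
  f ∈ tIdeal S

/-- The commutative law `x₀ x₁ - x₁ x₀`. -/
noncomputable def commutativity (F : Type*) [Field F] : NAPoly F :=
  var F 0 * var F 1 - var F 1 * var F 0

/-- `((a,b,c),d,b) + ((c,b,d),a,b) + ((d,b,a),c,b)`, where `(x,y,z) = (xy)z - x(yz)`. -/
def threeAssociatorsExpr {A : Type*} [NonUnitalNonAssocRing A] (a b c d : A) : A :=
  associator (associator a b c) d b + associator (associator c b d) a b
    + associator (associator d b a) c b

/-- The three associators identity, with `a, b, c, d` the variables `x₀, x₁, x₂, x₃`. -/
noncomputable def threeAssociators (F : Type*) [Field F] : NAPoly F :=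
  threeAssociatorsExpr (var F 0) (var F 1) (var F 2) (var F 3)

end PolyIdentity

/-! The split spin factor algebras. -/

/-- The underlying space `F z₁ ⊕ F z₂ ⊕ E` of the algebra `S(α,t,E)`; the element
`a z₁ + b z₂ + v` is `⟨a, b, v⟩`. -/
@[ext]
structure SplitSpin {F E : Type*} [Field F] [AddCommGroup E] [Module F E]
    (α t : F) (B : LinearMap.BilinForm F E) where
  /-- the coefficient at `z₁` -/
  c₁ : F
  /-- the coefficient at `z₂` -/
  c₂ : F
  /-- the component in `E` -/
  vec : E

namespace SplitSpin

/-- The identification of `S(α,t,E)` with `F × F × E`, which defines its vector space structure. -/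
def equivProd {F E : Type*} [Field F] [AddCommGroup E] [Module F E]
    (α t : F) (B : LinearMap.BilinForm F E) : SplitSpin α t B ≃ F × F × E where
  toFun x := (x.c₁, x.c₂, x.vec)
  invFun p := ⟨p.1, p.2.1, p.2.2⟩

instance {F E : Type*} [Field F] [AddCommGroup E] [Module F E]
    (α t : F) (B : LinearMap.BilinForm F E) : AddCommGroup (SplitSpin α t B) :=
  (equivProd α t B).addCommGroup

instance {F E : Type*} [Field F] [AddCommGroup E] [Module F E]
    (α t : F) (B : LinearMap.BilinForm F E) : Module F (SplitSpin α t B) :=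
  (equivProd α t B).module F

/-- The bilinear product determined by `z₁² = z₁`, `z₂² = z₂`, `z₁z₂ = z₂z₁ = 0`,
`e z₁ = z₁ e = α e`, `e z₂ = z₂ e = (1 - α) e`, `e f = ⟨e, f⟩ (z₁ + t z₂)` for `e, f ∈ E`. -/
instance {F E : Type*} [Field F] [AddCommGroup E] [Module F E]
    (α t : F) (B : LinearMap.BilinForm F E) : Mul (SplitSpin α t B) where
  mul x y :=
    { c₁ := x.c₁ * y.c₁ + B x.vec y.vec
      c₂ := x.c₂ * y.c₂ + t * B x.vec y.vec
      vec := (α * x.c₁ + (1 - α) * x.c₂) • y.vec + (α * y.c₁ + (1 - α) * y.c₂) • x.vec }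

@[simp]
theorem c₁_add {F E : Type*} [Field F] [AddCommGroup E] [Module F E]
    {α t : F} {B : LinearMap.BilinForm F E} (x y : SplitSpin α t B) :
    (x + y).c₁ = x.c₁ + y.c₁ := rfl

@[simp]
theorem c₂_add {F E : Type*} [Field F] [AddCommGroup E] [Module F E]
    {α t : F} {B : LinearMap.BilinForm F E} (x y : SplitSpin α t B) :
    (x + y).c₂ = x.c₂ + y.c₂ := rfl

@[simp]
theorem vec_add {F E : Type*} [Field F] [AddCommGroup E] [Module F E]
    {α t : F} {B : LinearMap.BilinForm F E} (x y : SplitSpin α t B) :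
    (x + y).vec = x.vec + y.vec := rfl

@[simp]
theorem c₁_zero {F E : Type*} [Field F] [AddCommGroup E] [Module F E]
    {α t : F} {B : LinearMap.BilinForm F E} :
    (0 : SplitSpin α t B).c₁ = 0 := rfl

@[simp]
theorem c₂_zero {F E : Type*} [Field F] [AddCommGroup E] [Module F E]
    {α t : F} {B : LinearMap.BilinForm F E} :
    (0 : SplitSpin α t B).c₂ = 0 := rfl

@[simp]
theorem vec_zero {F E : Type*} [Field F] [AddCommGroup E] [Module F E]
    {α t : F} {B : LinearMap.BilinForm F E} :
    (0 : SplitSpin α t B).vec = 0 := rfl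

@[simp]
theorem c₁_smul {F E : Type*} [Field F] [AddCommGroup E] [Module F E]
    {α t : F} {B : LinearMap.BilinForm F E} (c : F) (x : SplitSpin α t B) :
    (c • x).c₁ = c • x.c₁ := rfl

@[simp]
theorem c₂_smul {F E : Type*} [Field F] [AddCommGroup E] [Module F E]
    {α t : F} {B : LinearMap.BilinForm F E} (c : F) (x : SplitSpin α t B) :
    (c • x).c₂ = c • x.c₂ := rfl

@[simp]
theorem vec_smul {F E : Type*} [Field F] [AddCommGroup E] [Module F E]
    {α t : F} {B : LinearMap.BilinForm F E} (c : F) (x : SplitSpin α t B) :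
    (c • x).vec = c • x.vec := rfl

@[simp]
theorem c₁_mul {F E : Type*} [Field F] [AddCommGroup E] [Module F E]
    {α t : F} {B : LinearMap.BilinForm F E} (x y : SplitSpin α t B) :
    (x * y).c₁ = x.c₁ * y.c₁ + B x.vec y.vec := rfl

@[simp]
theorem c₂_mul {F E : Type*} [Field F] [AddCommGroup E] [Module F E]
    {α t : F} {B : LinearMap.BilinForm F E} (x y : SplitSpin α t B) :
    (x * y).c₂ = x.c₂ * y.c₂ + t * B x.vec y.vec := rfl

@[simp]
theorem vec_mul {F E : Type*} [Field F] [AddCommGroup E] [Module F E]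
    {α t : F} {B : LinearMap.BilinForm F E} (x y : SplitSpin α t B) :
    (x * y).vec =
      (α * x.c₁ + (1 - α) * x.c₂) • y.vec + (α * y.c₁ + (1 - α) * y.c₂) • x.vec := rfl

instance {F E : Type*} [Field F] [AddCommGroup E] [Module F E]
    (α t : F) (B : LinearMap.BilinForm F E) :
    NonUnitalNonAssocRing (SplitSpin α t B) where
  left_distrib x y z := by
    ext
    · simp; ring
    · simp; ring
    · simp; module
  right_distrib x y z := by
    ext
    · simp; ring
    · simp; ring
    · simp; module
  zero_mul x := by ext <;> simp
  mul_zero x := by ext <;> simp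

instance {F E : Type*} [Field F] [AddCommGroup E] [Module F E]
    (α t : F) (B : LinearMap.BilinForm F E) :
    IsScalarTower F (SplitSpin α t B) (SplitSpin α t B) where
  smul_assoc c x y := by
    ext
    · simp; ring
    · simp; ring
    · simp; module

instance {F E : Type*} [Field F] [AddCommGroup E] [Module F E]
    (α t : F) (B : LinearMap.BilinForm F E) :
    SMulCommClass F (SplitSpin α t B) (SplitSpin α t B) where
  smul_comm c x y := by
    ext
    · simp; ring
    · simp; ring
    · simp; module

end SplitSpin

/-- The split spin factor algebra `S(α,E) = S(α,t,E)` with `t = (α² - 1) / (α (α - 2))`. -/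
abbrev SplitSpinFactor {F E : Type*} [Field F] [AddCommGroup E] [Module F E]
    (α : F) (B : LinearMap.BilinForm F E) : Type _ :=
  SplitSpin α ((α ^ 2 - 1) / (α * (α - 2))) B

/-! Because `F` is infinite, `f` may be replaced by its homogeneous components. Modulo
commutativity, a component of degree n is a combination of one bracketing if n ≤ 3, two if n = 4,
three if n = 5. Polarization, with each argument carrying a label that records the variable it
replaces, yields multilinear identities of S(α,E) whose coefficients `p`, `q`, `r` are functions of
the labels. Repeated variables of `f` thus become repeated labels and need no separate treatment.

The algebra S(α,E) has the unit 1 = z₁ + z₂, an element w killing E with w² = w + γ, where γ = α(1 -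
α)/(1 - 2α)², and two orthogonal anisotropic vectors e, f (`exists_spinFrame`). The conditions on α
give γ ≠ 0 and 2 + 9γ ≠ 0. Evaluation at a few tuples built from 1, w, e, f kills all coefficients
up to degree four. In degree five, setting a variable equal to 1 gives identities of degree four,
hence linear relations; the tuples eefww, eeffw, eefff give the others (`SpinFrame.coeffEquations`).

These relations force `q` = 0, express `r` through `p`, and write `p` through a function `T`
alternating in three labels and symmetric in the other two (`CoeffEquations.exists_alternating`).
The crux is that a certain sum of two values of `r` vanishes, an eigenvalue question about the 15
perfect matchings of six points (`eq_zero_of_collinearity`).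

Conversely, the linearized three associators identity makes the sum of ((b,a,c),d,e) weighted by
such a `T` vanish (`sum_associator_eq_zero`). Hence a combination with these coefficients is zero in
every commutative algebra satisfying that identity (`sum_shape₅_eq_zero`), in particular in the
relatively free one, which says that `f` lies in the T-ideal. -/

namespace PolyIdentity

/-! ### T-ideals and relatively free algebras. -/

section TIdeal

variable {F : Type*} [Field F]

theorem isTIdeal_tIdeal (S : Set (NAPoly F)) : IsTIdeal (tIdeal S) where
  mul_mem_left f g hg := by
    rw [tIdeal, Submodule.mem_sInf] at hg ⊢
    exact fun I hI => hI.1.mul_mem_left f g (hg I hI)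
  mul_mem_right f g hf := by
    rw [tIdeal, Submodule.mem_sInf] at hf ⊢
    exact fun I hI => hI.1.mul_mem_right f g (hf I hI)
  map_mem φ f hf := by
    rw [tIdeal, Submodule.mem_sInf] at hf ⊢
    exact fun I hI => hI.1.map_mem φ f (hf I hI)

theorem subset_tIdeal (S : Set (NAPoly F)) : S ⊆ tIdeal S := fun f hf => by
  rw [SetLike.mem_coe, tIdeal, Submodule.mem_sInf]
  exact fun I hI => hI.2 hf

theorem tIdeal_le {S : Set (NAPoly F)} {I : Submodule F (NAPoly F)} (hI : IsTIdeal I)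
    (h : S ⊆ I) : tIdeal S ≤ I := sInf_le ⟨hI, h⟩

/-- The identities of an algebra, as a submodule of the free algebra. -/
def identities (F : Type*) [Field F] (A : Type*) [NonUnitalNonAssocRing A] [Module F A]
    [IsScalarTower F A A] [SMulCommClass F A A] : Submodule F (NAPoly F) where
  carrier := {f | IsIdentityOf f A}
  add_mem' hf hg x := by rw [map_add, hf x, hg x, add_zero]
  zero_mem' x := map_zero _
  smul_mem' c f hf x := by rw [map_smul, hf x, smul_zero]

theorem isTIdeal_identities (A : Type*) [NonUnitalNonAssocRing A] [Module F A]
    [IsScalarTower F A A] [SMulCommClass F A A] : IsTIdeal (identities F A) where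
  mul_mem_left f g hg x := by rw [map_mul, hg x, mul_zero]
  mul_mem_right f g hf x := by rw [map_mul, hf x, zero_mul]
  map_mem φ f hf x := by
    have h : (FreeNonUnitalNonAssocAlgebra.lift F x).comp φ =
        FreeNonUnitalNonAssocAlgebra.lift F
          (fun i => FreeNonUnitalNonAssocAlgebra.lift F x (φ (var F i))) := by
      refine FreeNonUnitalNonAssocAlgebra.hom_ext F fun i => ?_
      simp [var]
    have := hf (fun i => FreeNonUnitalNonAssocAlgebra.lift F x (φ (var F i)))
    rw [← h] at this
    exact this

/-- The relatively free algebra of the variety defined by a set of identities. -/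
def RelFree (S : Set (NAPoly F)) : Type _ := NAPoly F ⧸ tIdeal S

namespace RelFree

variable (S : Set (NAPoly F))

noncomputable instance : AddCommGroup (RelFree S) :=
  inferInstanceAs (AddCommGroup (NAPoly F ⧸ tIdeal S))

noncomputable instance : Module F (RelFree S) :=
  inferInstanceAs (Module F (NAPoly F ⧸ tIdeal S))

/-- The quotient map. -/
noncomputable def mk : NAPoly F →ₗ[F] RelFree S := (tIdeal S).mkQ

variable {S}

theorem mk_surjective : Function.Surjective (mk S) := (tIdeal S).mkQ_surjective

theorem mk_eq_zero {f : NAPoly F} : mk S f = 0 ↔ f ∈ tIdeal S :=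
  Submodule.Quotient.mk_eq_zero _

theorem mk_eq_mk {f g : NAPoly F} : mk S f = mk S g ↔ f - g ∈ tIdeal S := by
  rw [← mk_eq_zero, map_sub, sub_eq_zero]

noncomputable instance : Mul (RelFree S) where
  mul := Quotient.map₂ (· * ·) (by
    intro f f' hf g g' hg
    have hf' : f - f' ∈ tIdeal S := (Submodule.quotientRel_def _).1 hf
    have hg' : g - g' ∈ tIdeal S := (Submodule.quotientRel_def _).1 hg
    refine (Submodule.quotientRel_def _).2 ?_
    have : f * g - f' * g' = (f - f') * g + f' * (g - g') := by
      rw [sub_mul, mul_sub]; abel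
    simp only [this]
    exact add_mem ((isTIdeal_tIdeal S).mul_mem_right _ _ hf')
      ((isTIdeal_tIdeal S).mul_mem_left _ _ hg'))

theorem mk_mul (f g : NAPoly F) : mk S (f * g) = mk S f * mk S g := rfl

noncomputable instance : NonUnitalNonAssocRing (RelFree S) where
  left_distrib x y z := by
    obtain ⟨x, rfl⟩ := mk_surjective x
    obtain ⟨y, rfl⟩ := mk_surjective y
    obtain ⟨z, rfl⟩ := mk_surjective z
    rw [← map_add, ← mk_mul, ← mk_mul, ← mk_mul, ← map_add, mul_add]
  right_distrib x y z := by
    obtain ⟨x, rfl⟩ := mk_surjective x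
    obtain ⟨y, rfl⟩ := mk_surjective y
    obtain ⟨z, rfl⟩ := mk_surjective z
    rw [← map_add, ← mk_mul, ← mk_mul, ← mk_mul, ← map_add, add_mul]
  zero_mul x := by
    obtain ⟨x, rfl⟩ := mk_surjective x
    rw [← map_zero (mk S), ← mk_mul, zero_mul]
  mul_zero x := by
    obtain ⟨x, rfl⟩ := mk_surjective x
    rw [← map_zero (mk S), ← mk_mul, mul_zero]

instance : IsScalarTower F (RelFree S) (RelFree S) where
  smul_assoc c x y := by
    obtain ⟨x, rfl⟩ := mk_surjective x
    obtain ⟨y, rfl⟩ := mk_surjective y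
    rw [smul_eq_mul, smul_eq_mul, ← map_smul, ← mk_mul, ← mk_mul, ← map_smul, smul_mul_assoc]

instance : SMulCommClass F (RelFree S) (RelFree S) where
  smul_comm c x y := by
    obtain ⟨x, rfl⟩ := mk_surjective x
    obtain ⟨y, rfl⟩ := mk_surjective y
    rw [smul_eq_mul, smul_eq_mul, ← map_smul, ← mk_mul, ← mk_mul, ← map_smul, mul_smul_comm]

variable (S) in
/-- The quotient map as a homomorphism of algebras. -/
noncomputable def mkHom : NAPoly F →ₙₐ[F] RelFree S :=
  { toFun := mk S
    map_smul' := map_smul (mk S)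
    map_zero' := map_zero (mk S)
    map_add' := map_add (mk S)
    map_mul' := mk_mul }

theorem mkHom_apply (f : NAPoly F) : mkHom S f = mk S f := rfl

theorem lift_mk (g : ℕ → NAPoly F) (f : NAPoly F) :
    FreeNonUnitalNonAssocAlgebra.lift F (fun i => mk S (g i)) f =
      mk S (FreeNonUnitalNonAssocAlgebra.lift F g f) := by
  have h : FreeNonUnitalNonAssocAlgebra.lift F (fun i => mk S (g i)) =
      (mkHom S).comp (FreeNonUnitalNonAssocAlgebra.lift F g) := by
    refine FreeNonUnitalNonAssocAlgebra.hom_ext F fun i => ?_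
    simp [mkHom_apply]
  rw [h]
  rfl

/-- Elements of the quotient lift to polynomials, so every substitution in the quotient is induced
by an endomorphism of the free algebra, and a T-ideal is stable under these. -/
theorem isIdentityOf {f : NAPoly F} (hf : f ∈ tIdeal S) : IsIdentityOf f (RelFree S) := by
  intro x
  choose g hg using fun i => mk_surjective (x i)
  obtain rfl : (fun i => mk S (g i)) = x := funext hg
  rw [lift_mk, mk_eq_zero]
  exact (isTIdeal_tIdeal S).map_mem _ _ hf

theorem mul_comm_of_mem (h : commutativity F ∈ S) (x y : RelFree S) : x * y = y * x := by
  have := isIdentityOf (subset_tIdeal S h) (fun i => if i = 0 then x else y)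
  simpa [commutativity, var, sub_eq_zero] using this

theorem threeAssociators_of_mem (h : threeAssociators F ∈ S) (a b c d : RelFree S) :
    threeAssociatorsExpr a b c d = 0 := by
  have := isIdentityOf (subset_tIdeal S h)
    (fun i => if i = 0 then a else if i = 1 then b else if i = 2 then c else d)
  simpa [threeAssociators, threeAssociatorsExpr, var, associator] using this

end RelFree

end TIdeal

/-! ### Reduction to homogeneous polynomials. -/

section Homogeneous

variable {F : Type*} [Field F]

theorem lift_eq_sum {A : Type*} [NonUnitalNonAssocRing A] [Module F A]
    [IsScalarTower F A A] [SMulCommClass F A A] (x : ℕ → A) (f : NAPoly F) :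
    FreeNonUnitalNonAssocAlgebra.lift F x f =
      f.coeff.sum fun m c => c • FreeMagma.lift x m := rfl

/-- The homogeneous component of degree `n`. -/
noncomputable def homComp (n : ℕ) (f : NAPoly F) : NAPoly F :=
  MonoidAlgebra.ofCoeff (f.coeff.filter fun m => m.length = n)

theorem mem_support_homComp {n : ℕ} {f : NAPoly F} {m : FreeMagma ℕ}
    (hm : m ∈ (homComp n f).coeff.support) : m.length = n := by
  simp only [homComp, MonoidAlgebra.coeff_ofCoeff, Finsupp.support_filter,
    Finset.mem_filter] at hm
  exact hm.2

theorem sum_homComp {f : NAPoly F} {n : ℕ} (hf : DegreeLE f n) :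
    ∑ k ∈ Finset.range (n + 1), homComp k f = f := by
  refine MonoidAlgebra.coeff_injective ?_
  ext m
  rw [MonoidAlgebra.coeff_sum, Finsupp.finsetSum_apply]
  simp only [homComp, MonoidAlgebra.coeff_ofCoeff, Finsupp.filter_apply]
  by_cases hm : f.coeff m = 0
  · simp [hm]
  · have := hf m (Finsupp.mem_support_iff.2 hm)
    rw [Finset.sum_ite_eq, if_pos (Finset.mem_range.2 (by omega))]

theorem lift_smul_of_length {A : Type*} [NonUnitalNonAssocRing A] [Module F A]
    [IsScalarTower F A A] [SMulCommClass F A A] (x : ℕ → A) (c : F) (m : FreeMagma ℕ) :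
    FreeMagma.lift (fun i => c • x i) m = c ^ m.length • FreeMagma.lift x m := by
  induction m using FreeMagma.recOnMul with
  | ih1 i => simp [FreeMagma.length]
  | ih2 a b ha hb =>
    have : (a * b).length = a.length + b.length := rfl
    rw [map_mul, map_mul, ha, hb, this, smul_mul_smul_comm, pow_add]

theorem lift_smul_homComp {A : Type*} [NonUnitalNonAssocRing A] [Module F A]
    [IsScalarTower F A A] [SMulCommClass F A A] (x : ℕ → A) (c : F) (n : ℕ) (f : NAPoly F) :
    FreeNonUnitalNonAssocAlgebra.lift F (fun i => c • x i) (homComp n f) =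
      c ^ n • FreeNonUnitalNonAssocAlgebra.lift F x (homComp n f) := by
  rw [lift_eq_sum, lift_eq_sum, Finsupp.smul_sum]
  refine Finset.sum_congr rfl fun m hm => ?_
  dsimp only
  rw [lift_smul_of_length, mem_support_homComp hm, smul_comm]

/-- A linear functional turns the hypothesis into a polynomial over an infinite field vanishing at
every point; functionals separate vectors. -/
theorem eq_zero_of_forall_sum_pow_smul [Infinite F] {V : Type*} [AddCommGroup V] [Module F V]
    {n : ℕ} {v : ℕ → V} (h : ∀ c : F, ∑ k ∈ Finset.range n, c ^ k • v k = 0) {k : ℕ}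
    (hk : k < n) : v k = 0 := by
  rw [← Module.forall_dual_apply_eq_zero_iff F]
  intro φ
  have hp : (∑ j ∈ Finset.range n, Polynomial.monomial j (φ (v j)) : Polynomial F) = 0 := by
    refine Polynomial.funext fun c => ?_
    have := congrArg φ (h c)
    simpa [Polynomial.eval_finsetSum, mul_comm] using this
  have := congrArg (fun p => Polynomial.coeff p k) hp
  simpa [Polynomial.finsetSum_coeff, Polynomial.coeff_monomial, hk] using this

theorem IsIdentityOf.homComp [Infinite F] {A : Type*} [NonUnitalNonAssocRing A] [Module F A]
    [IsScalarTower F A A] [SMulCommClass F A A] {f : NAPoly F} (hf : IsIdentityOf f A) {n k : ℕ}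
    (hn : DegreeLE f n) (hk : k ≤ n) : IsIdentityOf (homComp k f) A := by
  intro x
  refine eq_zero_of_forall_sum_pow_smul (F := F) (n := n + 1)
    (v := fun k => FreeNonUnitalNonAssocAlgebra.lift F x (PolyIdentity.homComp k f))
    (fun c => ?_) (Nat.lt_succ_of_le hk)
  have := hf (fun i => c • x i)
  rw [← sum_homComp hn, map_sum] at this
  simpa only [lift_smul_homComp] using this

theorem mem_of_homComp_mem {f : NAPoly F} {n : ℕ} (hf : DegreeLE f n)
    {I : Submodule F (NAPoly F)} (h : ∀ k ≤ n, homComp k f ∈ I) : f ∈ I := by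
  rw [← sum_homComp hf]
  exact sum_mem fun k hk => h k (Nat.lt_succ_iff.1 (Finset.mem_range.1 hk))

end Homogeneous

/-! ### Normal forms modulo a set of identities. -/

section NormalForm

/-- A strict bound for the variables occurring in a monomial. -/
def varBound : FreeMagma ℕ → ℕ
  | .of i => i + 1
  | .mul a b => max (varBound a) (varBound b)

/-- The monomial obtained by substituting `x` in a monomial in `n` variables. -/
abbrev shapeEval {n : ℕ} (M : FreeMagma (Fin n)) {A : Type*} [Mul A] (x : Fin n → A) : A :=
  FreeMagma.lift x M

theorem map_shapeEval {F : Type*} [Field F] {A A' : Type*} [NonUnitalNonAssocRing A] [Module F A]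
    [NonUnitalNonAssocRing A'] [Module F A'] (g : A →ₙₐ[F] A') {n : ℕ} (M : FreeMagma (Fin n))
    (x : Fin n → A) : g (shapeEval M x) = shapeEval M fun i => g (x i) := by
  induction M using FreeMagma.recOnMul with
  | ih1 i => rfl
  | ih2 a b ha hb => simp only [shapeEval, map_mul] at *; rw [ha, hb]

variable {F : Type*} [Field F]

/-- Bounding the variables by `N` makes the set of labelled shapes finite, so that coefficients form
a plain function. It need not be unique: commutativity identifies many labelled shapes, and the
later symmetrizations account for this. -/
theorem exists_mk_eq_sum {S : Set (NAPoly F)} {n N : ℕ} {κ : Type*} [Fintype κ]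
    (sh : κ → FreeMagma (Fin n)) {f : NAPoly F}
    (hsh : ∀ m : FreeMagma ℕ, m.length = n → varBound m ≤ N → ∃ (k : κ) (φ : Fin n → Fin N),
      FreeMagma.lift (fun i => RelFree.mk S (var F i)) m =
        shapeEval (sh k) fun i => RelFree.mk S (var F (φ i)))
    (hf : ∀ m ∈ f.coeff.support, m.length = n) (hN : ∀ m ∈ f.coeff.support, varBound m ≤ N) :
    ∃ c : κ × (Fin n → Fin N) → F, ∑ q, c q • (shapeEval (sh q.1)
      fun i => RelFree.mk S (var F (q.2 i))) = RelFree.mk S f := by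
  rw [← Submodule.mem_span_range_iff_exists_fun]
  have h := RelFree.lift_mk (S := S) (var F) f
  have h1 : FreeNonUnitalNonAssocAlgebra.lift F (var F) = NonUnitalAlgHom.id F (NAPoly F) := by
    refine FreeNonUnitalNonAssocAlgebra.hom_ext F fun i => ?_
    simp [var]
  rw [h1] at h
  change _ = RelFree.mk S f at h
  rw [← h, lift_eq_sum]
  refine Submodule.sum_mem _ fun m hm => Submodule.smul_mem _ _ ?_
  obtain ⟨k, φ, hk⟩ := hsh m (hf m hm) (hN m hm)
  rw [hk]
  exact Submodule.subset_span ⟨(k, φ), rfl⟩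

/-- A congruence modulo the T-ideal may be evaluated in any algebra satisfying `S`. One normal form
modulo commutativity therefore serves both S(α,E) and the relatively free algebra. -/
theorem lift_eq_sum_of_mk_eq {S : Set (NAPoly F)} {A : Type*} [NonUnitalNonAssocRing A]
    [Module F A] [IsScalarTower F A A] [SMulCommClass F A A]
    (hA : S ⊆ identities F A) {n N : ℕ} {κ : Type*} [Fintype κ]
    {sh : κ → FreeMagma (Fin n)} {f : NAPoly F} {c : κ × (Fin n → Fin N) → F}
    (hc : ∑ q, c q • (shapeEval (sh q.1)
      fun i => RelFree.mk S (var F (q.2 i))) = RelFree.mk S f) (x : ℕ → A) :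
    FreeNonUnitalNonAssocAlgebra.lift F x f =
      ∑ q, c q • shapeEval (sh q.1) fun i => x (q.2 i) := by
  have h : RelFree.mk S (∑ q, c q • shapeEval (sh q.1) fun i => var F (q.2 i)) =
      RelFree.mk S f := by
    rw [← hc, map_sum]
    refine Finset.sum_congr rfl fun q _ => ?_
    rw [map_smul]
    exact congrArg _ (map_shapeEval (RelFree.mkHom S) (sh q.1) _)
  rw [RelFree.mk_eq_mk] at h
  have := tIdeal_le (isTIdeal_identities A) hA h x
  rw [map_sub, sub_eq_zero] at this
  rw [← this, map_sum]
  refine Finset.sum_congr rfl fun q _ => ?_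
  rw [map_smul, map_shapeEval]
  simp [var]

theorem commutativity_mem_identities {A : Type*} [NonUnitalNonAssocRing A] [Module F A]
    [IsScalarTower F A A] [SMulCommClass F A A] (h : ∀ x y : A, x * y = y * x) :
    commutativity F ∈ identities F A := by
  intro x
  simp [commutativity, var, h (x 0) (x 1)]

end NormalForm

/-! ### Polarization with labelled arguments. -/

section Polarization

/-- Functions into `J` are partitioned by their exact image, and strong induction removes the proper
subsets: inclusion–exclusion without signs. -/
theorem sum_filter_image_eq_zero {ι κ A : Type*} [Fintype κ] [DecidableEq κ] [Fintype ι]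
    [DecidableEq ι] [AddCommGroup A] (G : (κ → ι) → A)
    (h : ∀ J : Finset ι, ∑ φ ∈ Fintype.piFinset fun _ => J, G φ = 0) (J : Finset ι) :
    ∑ φ with Finset.univ.image φ = J, G φ = 0 := by
  induction J using Finset.strongInduction with
  | H J ih =>
    have h1 : (Fintype.piFinset fun _ : κ => J) =
        J.powerset.biUnion fun K => {φ | Finset.univ.image φ = K} := by
      ext φ
      simp [Fintype.mem_piFinset, Finset.image_subset_iff]
    have h2 := h J
    rw [h1, Finset.sum_biUnion, ← Finset.insert_erase (Finset.mem_powerset_self J),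
      Finset.sum_insert (Finset.notMem_erase _ _)] at h2
    · have h3 : ∑ K ∈ J.powerset.erase J, ∑ φ with Finset.univ.image φ = K, G φ = 0 := by
        refine Finset.sum_eq_zero fun K hK => ?_
        rw [Finset.mem_erase, Finset.mem_powerset] at hK
        exact ih K (Finset.ssubset_iff_subset_ne.2 ⟨hK.2, hK.1⟩)
      rwa [h3, add_zero] at h2
    · intro K _ K' _ hKK'
      refine Finset.disjoint_left.2 fun φ hφ hφ' => hKK' ?_
      simp only [Finset.mem_filter, Finset.mem_univ, true_and] at hφ hφ'
      rw [← hφ, hφ']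

theorem sum_perm_eq_zero {κ A : Type*} [Fintype κ] [DecidableEq κ] [AddCommGroup A]
    (G : (κ → κ) → A) (h : ∀ J : Finset κ, ∑ φ ∈ Fintype.piFinset fun _ => J, G φ = 0) :
    ∑ σ : Equiv.Perm κ, G σ = 0 := by
  rw [← sum_filter_image_eq_zero G h Finset.univ]
  refine Finset.sum_bij (fun σ _ => (σ : κ → κ)) ?_ ?_ ?_ ?_
  · intro σ _
    simp [Finset.image_univ_of_surjective σ.surjective]
  · intro σ _ τ _ hστ
    exact Equiv.coe_fn_injective hστ
  · intro φ hφ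
    have hs : Function.Surjective φ := by
      intro b
      have hb := Finset.mem_univ b
      rw [← (Finset.mem_filter.1 hφ).2] at hb
      obtain ⟨a, -, ha⟩ := Finset.mem_image.1 hb
      exact ⟨a, ha⟩
    exact ⟨Equiv.ofBijective φ ⟨Finite.injective_iff_surjective.2 hs, hs⟩, Finset.mem_univ _, rfl⟩
  · exact fun _ _ => rfl

/-- If a linear combination of multilinear maps vanishes on all tuples formed by
the values of a function, then so do its polarizations. -/
theorem polarize {F A ι κ : Type*} [Field F] [AddCommGroup A] [Module F A] [Fintype ι]
    [DecidableEq ι] [Fintype κ] {n : ℕ} (μ : κ → MultilinearMap F (fun _ : Fin n => A) A)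
    (c : κ × (Fin n → ι) → F) (h : ∀ y : ι → A, ∑ q, c q • μ q.1 (fun i => y (q.2 i)) = 0)
    (i : Fin n → ι) (Y : Fin n → A) :
    ∑ σ : Equiv.Perm (Fin n), ∑ k, c (k, fun l => i (σ l)) • μ k (fun l => Y (σ l)) = 0 := by
  refine sum_perm_eq_zero (fun ψ => ∑ k, c (k, fun l => i (ψ l)) • μ k (fun l => Y (ψ l)))
    fun J => ?_
  -- The variable `a` receives the sum of all `Y j` with `j ∈ J` labelled `a`. Expanding by
  -- multilinearity leaves only those `ψ` whose labels spell the monomial.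
  have h1 := h fun a => ∑ j ∈ J, if i j = a then Y j else 0
  have h2 : ∀ q : κ × (Fin n → ι),
      μ q.1 (fun l => ∑ j ∈ J, if i j = q.2 l then Y j else 0) =
        ∑ ψ ∈ Fintype.piFinset fun _ : Fin n => J,
          if (fun l => i (ψ l)) = q.2 then μ q.1 (fun l => Y (ψ l)) else 0 := by
    intro q
    rw [(μ q.1).map_sum_finset (fun l j => if i j = q.2 l then Y j else 0) fun _ => J]
    refine Finset.sum_congr rfl fun ψ _ => ?_
    split_ifs with hψ
    · refine congrArg _ (funext fun l => if_pos (congrFun hψ l))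
    · obtain ⟨l, hl⟩ := Function.ne_iff.1 hψ
      exact (μ q.1).map_coord_zero l (if_neg hl)
  simp only [h2, Finset.smul_sum] at h1
  rw [Finset.sum_comm] at h1
  rw [← h1]
  refine Finset.sum_congr rfl fun ψ _ => ?_
  rw [Fintype.sum_prod_type]
  refine Finset.sum_congr rfl fun k _ => ?_
  simp [smul_ite]

theorem sum_perm_succ {X A : Type*} [AddCommMonoid A] {n : ℕ} (g : (Fin (n + 1) → X) → A)
    (y : Fin (n + 1) → X) :
    ∑ σ : Equiv.Perm (Fin (n + 1)), g (fun l => y (σ l)) =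
      ∑ i, ∑ τ : Equiv.Perm (Fin n),
        g (Fin.cons (y i) fun l => y (Equiv.swap 0 i (τ l).succ)) := by
  rw [← Equiv.sum_comp Equiv.Perm.decomposeFin.symm, Fintype.sum_prod_type]
  refine Finset.sum_congr rfl fun i _ => Finset.sum_congr rfl fun τ _ => congrArg g ?_
  ext l
  refine Fin.cases ?_ (fun l => ?_) l
  · simp
  · simp

end Polarization

/-! ### Explicit sums over permutations of at most five arguments. -/

section Permutations

variable {X A : Type*} [AddCommMonoid A]

/-- The sum of the values of a function at all permutations of two arguments. -/
def permSum₂ (g : X → X → A) (a b : X) : A := g a b + g b a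

/-- The sum of the values of a function at all permutations of three arguments. -/
def permSum₃ (g : X → X → X → A) (a b c : X) : A :=
  permSum₂ (g · · c) a b + permSum₂ (g · · b) a c + permSum₂ (g · · a) b c

/-- The sum of the values of a function at all permutations of four arguments. -/
def permSum₄ (g : X → X → X → X → A) (a b c d : X) : A :=
  permSum₃ (g · · · d) a b c + permSum₃ (g · · · c) a b d + permSum₃ (g · · · b) a c d +
    permSum₃ (g · · · a) b c d

/-- The sum of the values of a function at all permutations of five arguments. -/
def permSum₅ (g : X → X → X → X → X → A) (a b c d e : X) : A :=
  permSum₄ (g · · · · e) a b c d + permSum₄ (g · · · · d) a b c e +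
    permSum₄ (g · · · · c) a b d e + permSum₄ (g · · · · b) a c d e +
    permSum₄ (g · · · · a) b c d e

/-- Reversal of the positions turns the splitting by the first argument into one by the last, which
is the outermost factor of a left-normed monomial. -/
theorem sum_perm_last {n : ℕ} (g : (Fin (n + 1) → X) → A) (y : Fin (n + 1) → X) :
    ∑ σ : Equiv.Perm (Fin (n + 1)), g (fun l => y (σ l)) =
      ∑ i, ∑ τ : Equiv.Perm (Fin n),
        g (Fin.snoc (fun l => y (Equiv.swap 0 i (τ l).succ)) (y i)) := by
  rw [← Equiv.sum_comp (Equiv.mulRight (Fin.revPerm : Equiv.Perm (Fin (n + 1))))]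
  have h := sum_perm_succ (fun z => g (fun l => z l.rev)) y
  refine Eq.trans (Finset.sum_congr rfl fun σ _ => rfl) (h.trans ?_)
  refine Finset.sum_congr rfl fun i _ => ?_
  rw [← Equiv.sum_comp (Equiv.mulRight (Fin.revPerm : Equiv.Perm (Fin n)))]
  refine Finset.sum_congr rfl fun τ _ => congrArg g ?_
  ext l
  refine Fin.lastCases ?_ (fun l => ?_) l
  · simp
  · simp [Fin.rev_castSucc]

theorem sum_perm_two (g : (Fin 2 → X) → A) (a b : X) :
    ∑ σ : Equiv.Perm (Fin 2), g (fun l => ![a, b] (σ l)) =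
      permSum₂ (fun x y => g ![x, y]) a b := by
  have h : ∀ v w : Fin 2 → X, v 0 = w 0 → v 1 = w 1 → g v = g w := fun v w h0 h1 =>
    congrArg g (funext fun l => by fin_cases l <;> assumption)
  rw [sum_perm_last, Fin.sum_univ_two, permSum₂, add_comm]
  simp only [Finset.univ_unique, Finset.sum_singleton]
  congr 1 <;> exact h _ _ rfl rfl

theorem sum_perm_three (g : (Fin 3 → X) → A) (a b c : X) :
    ∑ σ : Equiv.Perm (Fin 3), g (fun l => ![a, b, c] (σ l)) =
      permSum₃ (fun x y z => g ![x, y, z]) a b c := by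
  have h : ∀ (v : Fin 2 → X) (z x y : X), v = ![x, y] →
      ∑ τ : Equiv.Perm (Fin 2), g (Fin.snoc (fun l => v (τ l)) z : Fin 3 → X) =
        permSum₂ (fun x y => g ![x, y, z]) x y := by
    rintro v z x y rfl
    rw [sum_perm_two fun v => g (Fin.snoc v z : Fin 3 → X)]
    congr 1; ext x y
    exact congrArg g (funext fun l => by fin_cases l <;> rfl)
  rw [sum_perm_last, Fin.sum_univ_three,
    h (fun l => ![a, b, c] (Equiv.swap 0 0 l.succ)) _ b c (by ext l; fin_cases l <;> rfl),
    h (fun l => ![a, b, c] (Equiv.swap 0 1 l.succ)) _ a c (by ext l; fin_cases l <;> rfl),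
    h (fun l => ![a, b, c] (Equiv.swap 0 2 l.succ)) _ b a (by ext l; fin_cases l <;> rfl)]
  simp only [permSum₃, permSum₂, Matrix.cons_val]
  abel

theorem sum_perm_four (g : (Fin 4 → X) → A) (a b c d : X) :
    ∑ σ : Equiv.Perm (Fin 4), g (fun l => ![a, b, c, d] (σ l)) =
      permSum₄ (fun x y z t => g ![x, y, z, t]) a b c d := by
  have h : ∀ (v : Fin 3 → X) (t x y z : X), v = ![x, y, z] →
      ∑ τ : Equiv.Perm (Fin 3), g (Fin.snoc (fun l => v (τ l)) t : Fin 4 → X) =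
        permSum₃ (fun x y z => g ![x, y, z, t]) x y z := by
    rintro v t x y z rfl
    rw [sum_perm_three fun v => g (Fin.snoc v t : Fin 4 → X)]
    congr 1; ext x y z
    exact congrArg g (funext fun l => by fin_cases l <;> rfl)
  rw [sum_perm_last, Fin.sum_univ_four,
    h (fun l => ![a, b, c, d] (Equiv.swap 0 0 l.succ)) _ b c d (by ext l; fin_cases l <;> rfl),
    h (fun l => ![a, b, c, d] (Equiv.swap 0 1 l.succ)) _ a c d (by ext l; fin_cases l <;> rfl),
    h (fun l => ![a, b, c, d] (Equiv.swap 0 2 l.succ)) _ b a d (by ext l; fin_cases l <;> rfl),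
    h (fun l => ![a, b, c, d] (Equiv.swap 0 3 l.succ)) _ b c a (by ext l; fin_cases l <;> rfl)]
  simp only [permSum₄, permSum₃, permSum₂, Matrix.cons_val]
  abel

/-- Removing an argument by means of `Equiv.swap 0 i` disturbs the order of the others; this and the
next two symmetries restore it in degree five. -/
theorem permSum₄_swap (g : X → X → X → X → A) (a b c d : X) :
    permSum₄ g b a c d = permSum₄ g a b c d := by
  simp only [permSum₄, permSum₃, permSum₂]
  abel

theorem permSum₄_rotate (g : X → X → X → X → A) (a b c d : X) :
    permSum₄ g b c d a = permSum₄ g a b c d := by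
  simp only [permSum₄, permSum₃, permSum₂]
  abel

theorem permSum₄_rotate_three (g : X → X → X → X → A) (a b c d : X) :
    permSum₄ g b c a d = permSum₄ g a b c d := by
  simp only [permSum₄, permSum₃, permSum₂]
  abel

theorem sum_perm_five (g : (Fin 5 → X) → A) (a b c d e : X) :
    ∑ σ : Equiv.Perm (Fin 5), g (fun l => ![a, b, c, d, e] (σ l)) =
      permSum₅ (fun x y z t u => g ![x, y, z, t, u]) a b c d e := by
  have h : ∀ (v : Fin 4 → X) (u x y z t : X), v = ![x, y, z, t] →
      ∑ τ : Equiv.Perm (Fin 4), g (Fin.snoc (fun l => v (τ l)) u : Fin 5 → X) =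
        permSum₄ (fun x y z t => g ![x, y, z, t, u]) x y z t := by
    rintro v u x y z t rfl
    rw [sum_perm_four fun v => g (Fin.snoc v u : Fin 5 → X)]
    congr 1; ext x y z t
    exact congrArg g (funext fun l => by fin_cases l <;> rfl)
  rw [sum_perm_last, Fin.sum_univ_five,
    h (fun l => ![a, b, c, d, e] (Equiv.swap 0 0 l.succ)) _ b c d e
      (by ext l; fin_cases l <;> rfl),
    h (fun l => ![a, b, c, d, e] (Equiv.swap 0 1 l.succ)) _ a c d e
      (by ext l; fin_cases l <;> rfl),
    h (fun l => ![a, b, c, d, e] (Equiv.swap 0 2 l.succ)) _ b a d e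
      (by ext l; fin_cases l <;> rfl),
    h (fun l => ![a, b, c, d, e] (Equiv.swap 0 3 l.succ)) _ b c a e
      (by ext l; fin_cases l <;> rfl),
    h (fun l => ![a, b, c, d, e] (Equiv.swap 0 4 l.succ)) _ b c d a
      (by ext l; fin_cases l <;> rfl)]
  simp only [Matrix.cons_val, permSum₄_swap _ a b d e, permSum₄_rotate_three _ a b c e,
    permSum₄_rotate _ a b c d, permSum₅]
  abel

end Permutations

/-! ### Commutative monomials of degree at most five. -/

section Shapes

open FreeMagma (of)

/-- The monomial of degree one. -/
def shape₁ : Unit → FreeMagma (Fin 1) := fun _ => of 0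

/-- The commutative monomial of degree two. -/
def shape₂ : Unit → FreeMagma (Fin 2) := fun _ => of 0 * of 1

/-- The commutative monomial of degree three. -/
def shape₃ : Unit → FreeMagma (Fin 3) := fun _ => of 0 * of 1 * of 2

/-- The commutative monomials of degree four. -/
def shape₄ : Fin 2 → FreeMagma (Fin 4) :=
  ![of 0 * of 1 * of 2 * of 3, of 0 * of 1 * (of 2 * of 3)]

/-- The commutative monomials of degree five. -/
def shape₅ : Fin 3 → FreeMagma (Fin 5) :=
  ![of 0 * of 1 * of 2 * of 3 * of 4, of 0 * of 1 * (of 2 * of 3) * of 4,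
    of 0 * of 1 * of 2 * (of 3 * of 4)]

section Multilinear

variable (F A : Type*) [Field F] [NonUnitalNonAssocRing A] [Module F A]

theorem exists_multilinear_shape₁ : ∃ μ : Unit → MultilinearMap F (fun _ : Fin 1 => A) A,
    ∀ k x, μ k x = shapeEval (shape₁ k) x :=
  ⟨fun _ => MultilinearMap.mk' (fun x => x 0) (by intro m i x y; fin_cases i; simp)
    (by intro m i c x; fin_cases i; simp), fun _ _ => rfl⟩

variable [IsScalarTower F A A] [SMulCommClass F A A]

theorem exists_multilinear_shape₂ : ∃ μ : Unit → MultilinearMap F (fun _ : Fin 2 => A) A,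
    ∀ k x, μ k x = shapeEval (shape₂ k) x :=
  ⟨fun _ => MultilinearMap.mk' (fun x => x 0 * x 1)
    (by intro m i x y; fin_cases i <;> simp [add_mul, mul_add])
    (by intro m i c x; fin_cases i <;> simp [smul_mul_assoc, mul_smul_comm]), fun _ _ => rfl⟩

theorem exists_multilinear_shape₃ : ∃ μ : Unit → MultilinearMap F (fun _ : Fin 3 => A) A,
    ∀ k x, μ k x = shapeEval (shape₃ k) x :=
  ⟨fun _ => MultilinearMap.mk' (fun x => x 0 * x 1 * x 2)
    (by intro m i x y; fin_cases i <;> simp [add_mul, mul_add])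
    (by intro m i c x; fin_cases i <;> simp [smul_mul_assoc, mul_smul_comm]), fun _ _ => rfl⟩

theorem exists_multilinear_shape₄ : ∃ μ : Fin 2 → MultilinearMap F (fun _ : Fin 4 => A) A,
    ∀ k x, μ k x = shapeEval (shape₄ k) x :=
  ⟨![MultilinearMap.mk' (fun x => x 0 * x 1 * x 2 * x 3)
    (by intro m i x y; fin_cases i <;> simp [add_mul, mul_add])
    (by intro m i c x; fin_cases i <;> simp [smul_mul_assoc, mul_smul_comm]),
    MultilinearMap.mk' (fun x => x 0 * x 1 * (x 2 * x 3))
    (by intro m i x y; fin_cases i <;> simp [add_mul, mul_add])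
    (by intro m i c x; fin_cases i <;> simp [smul_mul_assoc, mul_smul_comm])],
    fun k _ => by fin_cases k <;> rfl⟩

theorem exists_multilinear_shape₅ : ∃ μ : Fin 3 → MultilinearMap F (fun _ : Fin 5 => A) A,
    ∀ k x, μ k x = shapeEval (shape₅ k) x :=
  ⟨![MultilinearMap.mk' (fun x => x 0 * x 1 * x 2 * x 3 * x 4)
    (by intro m i x y; fin_cases i <;> simp [add_mul, mul_add])
    (by intro m i c x; fin_cases i <;> simp [smul_mul_assoc, mul_smul_comm]),
    MultilinearMap.mk' (fun x => x 0 * x 1 * (x 2 * x 3) * x 4)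
    (by intro m i x y; fin_cases i <;> simp [add_mul, mul_add])
    (by intro m i c x; fin_cases i <;> simp [smul_mul_assoc, mul_smul_comm]),
    MultilinearMap.mk' (fun x => x 0 * x 1 * x 2 * (x 3 * x 4))
    (by intro m i x y; fin_cases i <;> simp [add_mul, mul_add])
    (by intro m i c x; fin_cases i <;> simp [smul_mul_assoc, mul_smul_comm])],
    fun k _ => by fin_cases k <;> rfl⟩

end Multilinear

section Monomials

variable {A : Type*} [Mul A] {N : ℕ} {m : FreeMagma ℕ}

theorem exists_mul_of_length (h : 2 ≤ m.length) (hN : varBound m ≤ N) :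
    ∃ a b, m = a * b ∧ a.length + b.length = m.length ∧ 0 < a.length ∧ 0 < b.length ∧
      varBound a ≤ N ∧ varBound b ≤ N := by
  cases m with
  | of i => simp [FreeMagma.length] at h
  | mul a b =>
    exact ⟨a, b, rfl, rfl, a.length_pos, b.length_pos, (le_max_left _ _).trans hN,
      (le_max_right _ _).trans hN⟩

theorem exists_lift_of_length_one (y : ℕ → A) (h : m.length = 1) (hN : varBound m ≤ N) :
    ∃ i : Fin N, FreeMagma.lift y m = y i := by
  cases m with
  | of i => exact ⟨⟨i, hN⟩, rfl⟩
  | mul a b =>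
    have : a.length + b.length = 1 := h
    have := a.length_pos
    have := b.length_pos
    omega

theorem exists_lift_of_length_two (y : ℕ → A) (h : m.length = 2) (hN : varBound m ≤ N) :
    ∃ i j : Fin N, FreeMagma.lift y m = y i * y j := by
  obtain ⟨a, b, rfl, hl, ha, hb, hNa, hNb⟩ := exists_mul_of_length h.ge hN
  obtain ⟨i, hi⟩ := exists_lift_of_length_one y (by omega : a.length = 1) hNa
  obtain ⟨j, hj⟩ := exists_lift_of_length_one y (by omega : b.length = 1) hNb
  exact ⟨i, j, by rw [map_mul, hi, hj]⟩




theorem exists_lift_of_length_three (hcomm : ∀ x y : A, x * y = y * x) (y : ℕ → A) (h : m.length = 3) (hN : varBound m ≤ N) :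
    ∃ i j k : Fin N, FreeMagma.lift y m = y i * y j * y k := by
  obtain ⟨a, b, rfl, hl, ha, hb, hNa, hNb⟩ := exists_mul_of_length (by omega) hN
  rcases (by omega : a.length = 2 ∧ b.length = 1 ∨ a.length = 1 ∧ b.length = 2) with h | h
  · obtain ⟨i, j, hi⟩ := exists_lift_of_length_two y h.1 hNa
    obtain ⟨k, hk⟩ := exists_lift_of_length_one y h.2 hNb
    exact ⟨i, j, k, by rw [map_mul, hi, hk]⟩
  · obtain ⟨i, j, hi⟩ := exists_lift_of_length_two y h.2 hNb
    obtain ⟨k, hk⟩ := exists_lift_of_length_one y h.1 hNa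
    exact ⟨i, j, k, by rw [map_mul, hi, hk, hcomm]⟩

theorem exists_lift_of_length_four (hcomm : ∀ x y : A, x * y = y * x) (y : ℕ → A)
    (h : m.length = 4) (hN : varBound m ≤ N) :
    ∃ i j k l : Fin N, FreeMagma.lift y m = y i * y j * y k * y l ∨
      FreeMagma.lift y m = y i * y j * (y k * y l) := by
  obtain ⟨a, b, rfl, hl, ha, hb, hNa, hNb⟩ := exists_mul_of_length (by omega) hN
  rcases (by omega : a.length = 3 ∧ b.length = 1 ∨ a.length = 1 ∧ b.length = 3 ∨
    a.length = 2 ∧ b.length = 2) with h | h | h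
  · obtain ⟨i, j, k, hi⟩ := exists_lift_of_length_three hcomm y h.1 hNa
    obtain ⟨l, hl⟩ := exists_lift_of_length_one y h.2 hNb
    exact ⟨i, j, k, l, Or.inl (by rw [map_mul, hi, hl])⟩
  · obtain ⟨i, j, k, hi⟩ := exists_lift_of_length_three hcomm y h.2 hNb
    obtain ⟨l, hl⟩ := exists_lift_of_length_one y h.1 hNa
    exact ⟨i, j, k, l, Or.inl (by rw [map_mul, hi, hl, hcomm])⟩
  · obtain ⟨i, j, hi⟩ := exists_lift_of_length_two y h.1 hNa
    obtain ⟨k, l, hk⟩ := exists_lift_of_length_two y h.2 hNb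
    exact ⟨i, j, k, l, Or.inr (by rw [map_mul, hi, hk])⟩

theorem exists_lift_mul_of_length_four (hcomm : ∀ x y : A, x * y = y * x) (y : ℕ → A)
    (h : m.length = 4) (hN : varBound m ≤ N) (a : Fin N) :
    ∃ (k : Fin 3) (φ : Fin 5 → Fin N),
      FreeMagma.lift y m * y a = shapeEval (shape₅ k) fun i => y (φ i) := by
  obtain ⟨i, j, k, l, h | h⟩ := exists_lift_of_length_four hcomm y h hN
  · exact ⟨0, ![i, j, k, l, a], by rw [h]; rfl⟩
  · exact ⟨1, ![i, j, k, l, a], by rw [h]; rfl⟩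

theorem exists_lift_mul_of_length_three (hcomm : ∀ x y : A, x * y = y * x) (y : ℕ → A)
    (h : m.length = 3) (hN : varBound m ≤ N) (a b : Fin N) :
    ∃ (k : Fin 3) (φ : Fin 5 → Fin N),
      FreeMagma.lift y m * (y a * y b) = shapeEval (shape₅ k) fun i => y (φ i) := by
  obtain ⟨i, j, k, h⟩ := exists_lift_of_length_three hcomm y h hN
  exact ⟨2, ![i, j, k, a, b], by rw [h]; rfl⟩

theorem exists_shape₁ (y : ℕ → A) (h : m.length = 1) (hN : varBound m ≤ N) :
    ∃ (k : Unit) (φ : Fin 1 → Fin N),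
      FreeMagma.lift y m = shapeEval (shape₁ k) fun i => y (φ i) := by
  obtain ⟨i, h⟩ := exists_lift_of_length_one y h hN
  exact ⟨(), ![i], by rw [h]; rfl⟩

theorem exists_shape₂ (y : ℕ → A) (h : m.length = 2) (hN : varBound m ≤ N) :
    ∃ (k : Unit) (φ : Fin 2 → Fin N),
      FreeMagma.lift y m = shapeEval (shape₂ k) fun i => y (φ i) := by
  obtain ⟨i, j, h⟩ := exists_lift_of_length_two y h hN
  exact ⟨(), ![i, j], by rw [h]; rfl⟩

theorem exists_shape₃ (hcomm : ∀ x y : A, x * y = y * x) (y : ℕ → A) (h : m.length = 3)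
    (hN : varBound m ≤ N) :
    ∃ (k : Unit) (φ : Fin 3 → Fin N),
      FreeMagma.lift y m = shapeEval (shape₃ k) fun i => y (φ i) := by
  obtain ⟨i, j, k, h⟩ := exists_lift_of_length_three hcomm y h hN
  exact ⟨(), ![i, j, k], by rw [h]; rfl⟩

theorem exists_shape₄ (hcomm : ∀ x y : A, x * y = y * x) (y : ℕ → A) (h : m.length = 4)
    (hN : varBound m ≤ N) :
    ∃ (k : Fin 2) (φ : Fin 4 → Fin N),
      FreeMagma.lift y m = shapeEval (shape₄ k) fun i => y (φ i) := by
  obtain ⟨i, j, k, l, h | h⟩ := exists_lift_of_length_four hcomm y h hN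
  · exact ⟨0, ![i, j, k, l], by rw [h]; rfl⟩
  · exact ⟨1, ![i, j, k, l], by rw [h]; rfl⟩

theorem exists_shape₅ (hcomm : ∀ x y : A, x * y = y * x) (y : ℕ → A) (h : m.length = 5)
    (hN : varBound m ≤ N) :
    ∃ (k : Fin 3) (φ : Fin 5 → Fin N),
      FreeMagma.lift y m = shapeEval (shape₅ k) fun i => y (φ i) := by
  obtain ⟨a, b, rfl, hl, ha, hb, hNa, hNb⟩ := exists_mul_of_length (by omega) hN
  rcases (by omega : a.length = 4 ∧ b.length = 1 ∨ a.length = 1 ∧ b.length = 4 ∨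
    a.length = 3 ∧ b.length = 2 ∨ a.length = 2 ∧ b.length = 3) with h | h | h | h
  · obtain ⟨i, hi⟩ := exists_lift_of_length_one y h.2 hNb
    rw [map_mul, hi]
    exact exists_lift_mul_of_length_four hcomm y h.1 hNa i
  · obtain ⟨i, hi⟩ := exists_lift_of_length_one y h.1 hNa
    rw [map_mul, hi, hcomm]
    exact exists_lift_mul_of_length_four hcomm y h.2 hNb i
  · obtain ⟨i, j, hi⟩ := exists_lift_of_length_two y h.2 hNb
    rw [map_mul, hi]
    exact exists_lift_mul_of_length_three hcomm y h.1 hNa i j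
  · obtain ⟨i, j, hi⟩ := exists_lift_of_length_two y h.1 hNa
    rw [map_mul, hi, hcomm]
    exact exists_lift_mul_of_length_three hcomm y h.2 hNb i j

end Monomials

end Shapes

/-! ### Multilinear commutative polynomials with labelled coefficients. -/

section Multilinearized

variable {F ι A : Type*} [Field F] [NonUnitalNonAssocRing A] [Module F A]

/-- The general commutative multilinear polynomial of degree three: its coefficients depend
on labels `i, j, k` of the variables `x, y, z`. -/
def multi₃ (p : ι → ι → ι → F) (i j k : ι) (x y z : A) : A :=
  p i j k • (x * y * z) + p i k j • (x * z * y) + p j k i • (y * z * x)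

/-- The general commutative multilinear polynomial of degree four. -/
def multi₄ (p q : ι → ι → ι → ι → F) (i j k l : ι) (x y z t : A) : A :=
  multi₃ (p · · · l) i j k x y z * t + multi₃ (p · · · k) i j l x y t * z +
    multi₃ (p · · · j) i k l x z t * y + multi₃ (p · · · i) j k l y z t * x +
    q i j k l • (x * y * (z * t)) + q i k j l • (x * z * (y * t)) + q i l j k • (x * t * (y * z))

/-- The general commutative multilinear polynomial of degree five. -/
def multi₅ (p q r : ι → ι → ι → ι → ι → F) (i j k l m : ι) (x y z t u : A) : A :=
  multi₄ (p · · · · m) (q · · · · m) i j k l x y z t * u +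
    multi₄ (p · · · · l) (q · · · · l) i j k m x y z u * t +
    multi₄ (p · · · · k) (q · · · · k) i j l m x y t u * z +
    multi₄ (p · · · · j) (q · · · · j) i k l m x z t u * y +
    multi₄ (p · · · · i) (q · · · · i) j k l m y z t u * x +
    multi₃ (r · · · l m) i j k x y z * (t * u) + multi₃ (r · · · k m) i j l x y t * (z * u) +
    multi₃ (r · · · k l) i j m x y u * (z * t) + multi₃ (r · · · j m) i k l x z t * (y * u) +
    multi₃ (r · · · j l) i k m x z u * (y * t) + multi₃ (r · · · j k) i l m x t u * (y * z) +
    multi₃ (r · · · i m) j k l y z t * (x * u) + multi₃ (r · · · i l) j k m y z u * (x * t) +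
    multi₃ (r · · · i k) j l m y t u * (x * z) + multi₃ (r · · · i j) k l m z t u * (x * y)

theorem permSum₂_shape (hcomm : ∀ x y : A, x * y = y * x) (p : ι → ι → F) (i j : ι) (x y : A) :
    permSum₂ (fun a b : ι × A => p a.1 b.1 • (a.2 * b.2)) (i, x) (j, y) =
      (p i j + p j i) • (x * y) := by
  rw [permSum₂, hcomm y x, add_smul]

theorem permSum₃_shape (hcomm : ∀ x y : A, x * y = y * x) (p : ι → ι → ι → F) (i j k : ι)
    (x y z : A) :
    permSum₃ (fun a b c : ι × A => p a.1 b.1 c.1 • (a.2 * b.2 * c.2)) (i, x) (j, y) (k, z) =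
      multi₃ (fun a b c => p a b c + p b a c) i j k x y z := by
  simp only [permSum₃, permSum₂, multi₃, hcomm y x, hcomm z x, hcomm z y, add_smul]

variable [IsScalarTower F A A]

theorem permSum₃_mul {X : Type*} (g : X → X → X → A) (x : A) (a b c : X) :
    permSum₃ (fun a b c => g a b c * x) a b c = permSum₃ g a b c * x := by
  simp only [permSum₃, permSum₂, add_mul]

theorem permSum₄_mul {X : Type*} (g : X → X → X → X → A) (x : A) (a b c d : X) :
    permSum₄ (fun a b c d => g a b c d * x) a b c d = permSum₄ g a b c d * x := by
  simp only [permSum₄, permSum₃_mul, add_mul]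

theorem permSum₂_add {X : Type*} (g h : X → X → A) (a b : X) :
    permSum₂ (fun a b => g a b + h a b) a b = permSum₂ g a b + permSum₂ h a b := by
  simp only [permSum₂]; abel

theorem permSum₃_add {X : Type*} (g h : X → X → X → A) (a b c : X) :
    permSum₃ (fun a b c => g a b c + h a b c) a b c = permSum₃ g a b c + permSum₃ h a b c := by
  simp only [permSum₃, permSum₂_add]; abel

theorem permSum₄_add {X : Type*} (g h : X → X → X → X → A) (a b c d : X) :
    permSum₄ (fun a b c d => g a b c d + h a b c d) a b c d =
      permSum₄ g a b c d + permSum₄ h a b c d := by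
  simp only [permSum₄, permSum₃_add]; abel

/-- Symmetrization of the coefficients of the monomials `(a b)(c d)`. -/
def symmPairs (q : ι → ι → ι → ι → F) (a b c d : ι) : F :=
  q a b c d + q b a c d + q a b d c + q b a d c + q c d a b + q d c a b + q c d b a + q d c b a

theorem permSum₄_shape (hcomm : ∀ x y : A, x * y = y * x) (p q : ι → ι → ι → ι → F)
    (i j k l : ι) (x y z t : A) :
    permSum₄ (fun a b c d : ι × A => p a.1 b.1 c.1 d.1 • (a.2 * b.2 * c.2 * d.2) +
        q a.1 b.1 c.1 d.1 • (a.2 * b.2 * (c.2 * d.2))) (i, x) (j, y) (k, z) (l, t) =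
      multi₄ (fun a b c d => p a b c d + p b a c d) (symmPairs q) i j k l x y z t := by
  rw [permSum₄_add]
  have hp : permSum₄ (fun a b c d : ι × A => p a.1 b.1 c.1 d.1 • (a.2 * b.2 * c.2 * d.2))
      (i, x) (j, y) (k, z) (l, t) =
      multi₄ (fun a b c d => p a b c d + p b a c d) 0 i j k l x y z t := by
    have h3 : ∀ (i j k l : ι) (x y z t : A),
        permSum₃ (fun a b c : ι × A => p a.1 b.1 c.1 l • (a.2 * b.2 * c.2 * t))
          (i, x) (j, y) (k, z) = multi₃ (fun a b c => p a b c l + p b a c l) i j k x y z * t := by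
      intro i j k l x y z t
      rw [← permSum₃_shape hcomm, ← permSum₃_mul]
      simp only [smul_mul_assoc]
    simp only [permSum₄, h3, multi₄, Pi.zero_apply, zero_smul, add_zero]
  have hq : permSum₄ (fun a b c d : ι × A => q a.1 b.1 c.1 d.1 • (a.2 * b.2 * (c.2 * d.2)))
      (i, x) (j, y) (k, z) (l, t) =
      multi₄ 0 (symmPairs q) i j k l x y z t := by
    simp only [permSum₄, permSum₃, permSum₂, multi₄, multi₃, symmPairs, Pi.zero_apply, zero_smul,
      add_zero, zero_mul, zero_add]
    simp only [hcomm y x, hcomm z x, hcomm z y, hcomm t x, hcomm t y, hcomm t z,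
      hcomm (z * t) (x * y), hcomm (y * t) (x * z), hcomm (y * z) (x * t)]
    module
  rw [hp, hq]
  simp only [multi₄, multi₃, Pi.zero_apply, zero_smul, add_zero, zero_mul, zero_add]
  abel

/-- The three shapes have symmetry groups of orders 2, 8 and 4, so the 120 permutations give 60, 15
and 30 distinct monomials. The coefficient of each is the sum of the original coefficients over its
symmetry group. -/
theorem permSum₅_shape (hcomm : ∀ x y : A, x * y = y * x) (p q r : ι → ι → ι → ι → ι → F)
    (i j k l m : ι) (x y z t u : A) :
    permSum₅ (fun a b c d e : ι × A =>
        p a.1 b.1 c.1 d.1 e.1 • (a.2 * b.2 * c.2 * d.2 * e.2) +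
        q a.1 b.1 c.1 d.1 e.1 • (a.2 * b.2 * (c.2 * d.2) * e.2) +
        r a.1 b.1 c.1 d.1 e.1 • (a.2 * b.2 * c.2 * (d.2 * e.2)))
        (i, x) (j, y) (k, z) (l, t) (m, u) =
      multi₅ (fun a b c d e => p a b c d e + p b a c d e)
        (fun a b c d e => symmPairs (q · · · · e) a b c d)
        (fun a b c d e => r a b c d e + r b a c d e + r a b c e d + r b a c e d)
        i j k l m x y z t u := by
  have hpq : ∀ (i j k l m : ι) (x y z t u : A),
      permSum₄ (fun a b c d : ι × A => p a.1 b.1 c.1 d.1 m • (a.2 * b.2 * c.2 * d.2 * u) +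
        q a.1 b.1 c.1 d.1 m • (a.2 * b.2 * (c.2 * d.2) * u)) (i, x) (j, y) (k, z) (l, t) =
      multi₄ (fun a b c d => p a b c d m + p b a c d m) (symmPairs (q · · · · m))
        i j k l x y z t * u := by
    intro i j k l m x y z t u
    rw [← permSum₄_shape hcomm, ← permSum₄_mul]
    simp only [add_mul, smul_mul_assoc]
  have hr : ∀ (i j k l m : ι) (x y z t u : A),
      permSum₃ (fun a b c : ι × A => r a.1 b.1 c.1 l m • (a.2 * b.2 * c.2 * (t * u)))
        (i, x) (j, y) (k, z) =
      multi₃ (fun a b c => r a b c l m + r b a c l m) i j k x y z * (t * u) := by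
    intro i j k l m x y z t u
    rw [← permSum₃_shape hcomm, ← permSum₃_mul]
    simp only [smul_mul_assoc]
  have hpqr : ∀ (i j k l m : ι) (x y z t u : A),
      permSum₄ (fun a b c d : ι × A => p a.1 b.1 c.1 d.1 m • (a.2 * b.2 * c.2 * d.2 * u) +
        q a.1 b.1 c.1 d.1 m • (a.2 * b.2 * (c.2 * d.2) * u) +
        r a.1 b.1 c.1 d.1 m • (a.2 * b.2 * c.2 * (d.2 * u))) (i, x) (j, y) (k, z) (l, t) =
      multi₄ (fun a b c d => p a b c d m + p b a c d m) (symmPairs (q · · · · m))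
        i j k l x y z t * u +
      permSum₄ (fun a b c d : ι × A => r a.1 b.1 c.1 d.1 m • (a.2 * b.2 * c.2 * (d.2 * u)))
        (i, x) (j, y) (k, z) (l, t) := by
    intro i j k l m x y z t u
    rw [← hpq, ← permSum₄_add]
  simp only [permSum₅, hpqr]
  simp only [permSum₄, hr, multi₅]
  have hadd : ∀ (l m : ι) (i j k : ι) (x y z : A),
      multi₃ (fun a b c => r a b c l m + r b a c l m + r a b c m l + r b a c m l) i j k x y z =
      multi₃ (fun a b c => r a b c l m + r b a c l m) i j k x y z +
      multi₃ (fun a b c => r a b c m l + r b a c m l) i j k x y z := by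
    intros
    simp only [multi₃]
    module
  simp only [hadd, add_mul, hcomm y x, hcomm z x, hcomm z y, hcomm t x, hcomm t y, hcomm t z,
    hcomm u x, hcomm u y, hcomm u z, hcomm u t]
  abel

end Multilinearized

/-! ### Evaluation at 1, w, e, f. -/

section Evaluation

/-- Elements `1, w, e, f` of an algebra with `w² = w + γ`, `we = wf = ef = 0`, and `e²`, `f²` nonzero
multiples of `w - (1 + 3γ)`. -/
structure SpinFrame (F : Type*) {A : Type*} [Field F] [NonUnitalNonAssocRing A] [Module F A]
    (γ n m : F) (o w e f : A) : Prop where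
  mul_comm : ∀ x y : A, x * y = y * x
  one_mul : ∀ x : A, o * x = x
  w_mul_w : w * w = w + γ • o
  w_mul_e : w * e = 0
  w_mul_f : w * f = 0
  e_mul_f : e * f = 0
  e_mul_e : e * e = n • (w - (1 + 3 * γ) • o)
  f_mul_f : f * f = m • (w - (1 + 3 * γ) • o)
  indep : ∀ a b : F, a • o + b • w = 0 → a = 0 ∧ b = 0
  e_ne_zero : e ≠ 0
  f_ne_zero : f ≠ 0
  n_ne_zero : n ≠ 0
  m_ne_zero : m ≠ 0

/-- The linear equations between the coefficients of the identities of degree five. -/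
structure CoeffEquations {F ι : Type*} [Field F] (γ : F)
    (p q r : ι → ι → ι → ι → ι → F) : Prop where
  p_comm : ∀ a b c d e, p a b c d e = p b a c d e
  q_comm : ∀ a b c d e, q a b c d e = q b a c d e
  q_swap : ∀ a b c d e, q a b c d e = q c d a b e
  r_comm : ∀ a b c d e, r a b c d e = r b a c d e
  r_comm' : ∀ a b c d e, r a b c d e = r a b c e d
  insert₁ : ∀ a b c d k, p a k b c d + p b k a c d + p a b k c d + p a b c k d + p a b c d k +
    q a b c k d + r a b c d k = 0
  insert₂ : ∀ a b c d k, r a k b c d + r b k a c d + r a b k c d + r c k d a b + r d k c a b +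
    r c d k a b + q a b c d k = 0
  eefww : ∀ a b c d d', (1 + 3 * γ) * (r a b c d d' + r d d' c a b + p d d' a b c + p d d' b a c) +
        3 * γ * (q a b d d' c + p a b d d' c + p a b d' d c) = 0
  eeffw₀ : ∀ a b c d k, (1 + 3 * γ) * (p a b k c d + p a b k d c + p c d k a b + p c d k b a +
          p a b c d k + p a b d c k + p c d a b k + p c d b a k) +
        (1 + 6 * γ) * (r a b k c d + r c d k a b + q a b c d k) = 0
  eeffw₁ : ∀ a b c d k, p a b k c d + p a b k d c + p c d k a b + p c d k b a +
        (1 + 9 * γ) * (r a b k c d + r c d k a b + q a b c d k) +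
        (3 + 9 * γ) * (p a b c d k + p a b d c k + p c d a b k + p c d b a k) = 0
  eefff : ∀ a b c d k, (1 + 3 * γ) ^ 2 * (r a b k c d + r c d k a b + r a b d c k + r c k d a b +
          r a b c d k + r d k c a b +
          p a b c d k + p a b d c k + p c d a b k + p c d b a k +
          p a b c k d + p a b k c d + p c k a b d + p c k b a d +
          p a b d k c + p a b k d c + p d k a b c + p d k b a c) +
        (1 + 7 * γ + 9 * γ ^ 2) * (q a b c d k + q a b c k d + q a b d k c) = 0

namespace SpinFrame

variable {F ι A : Type*} [Field F] [NonUnitalNonAssocRing A] [Module F A] {γ n m : F} {o w e f : A}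

theorem mul_one (h : SpinFrame F γ n m o w e f) (x : A) : x * o = x := by
  rw [h.mul_comm, h.one_mul]

theorem e_mul_w (h : SpinFrame F γ n m o w e f) : e * w = 0 := by rw [h.mul_comm, h.w_mul_e]

theorem f_mul_w (h : SpinFrame F γ n m o w e f) : f * w = 0 := by rw [h.mul_comm, h.w_mul_f]

theorem f_mul_e (h : SpinFrame F γ n m o w e f) : f * e = 0 := by rw [h.mul_comm, h.e_mul_f]

theorem coeff₁_eq_zero (h : SpinFrame F γ n m o w e f) {p : F} (H : ∀ x : A, p • x = 0) :
    p = 0 := by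
  simpa [h.e_ne_zero] using H e

variable [IsScalarTower F A A]

theorem multi₃_wwe (h : SpinFrame F γ n m o w e f) (p : ι → ι → ι → F) (i j k : ι) :
    multi₃ p i j k w w e = (p i j k * γ) • e := by
  simp only [multi₃, h.one_mul, h.w_mul_w, h.w_mul_e, add_mul, zero_mul, smul_zero, smul_mul_assoc,
    zero_add, add_zero, smul_smul]

/-- Setting a variable equal to the unit deletes a factor; a monomial of lower degree collects the
coefficients of all monomials that collapse to it. -/
theorem multi₄_one (h : SpinFrame F γ n m o w e f) {p q : ι → ι → ι → ι → F}
    (hq : ∀ a b c d, q a b c d = q c d a b) (a b c k : ι) (x y z : A) :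
    multi₄ p q a b c k x y z o =
      multi₃ (fun a b c => p a k b c + p b k a c + p a b k c + p a b c k + q a b c k)
        a b c x y z := by
  simp only [multi₄, multi₃, h.mul_one, h.mul_comm y x, h.mul_comm z x, h.mul_comm z y,
    h.mul_comm x (y * z), hq a k b c, add_mul, smul_mul_assoc]
  module

theorem multi₅_one (h : SpinFrame F γ n m o w e f) {p q r : ι → ι → ι → ι → ι → F}
    (hq : ∀ a b c d e, q a b c d e = q c d a b e) (a b c d k : ι) (x y z t : A) :
    multi₅ p q r a b c d k x y z t o =
      multi₄ (fun a b c d => p a k b c d + p b k a c d + p a b k c d + p a b c k d + p a b c d k +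
          q a b c k d + r a b c d k)
        (fun a b c d => r a k b c d + r b k a c d + r a b k c d + r c k d a b + r d k c a b +
          r c d k a b + q a b c d k) a b c d x y z t := by
  simp only [multi₅, multi₄, multi₃, h.mul_one, h.mul_comm y x, h.mul_comm z x, h.mul_comm z y,
    h.mul_comm t x, h.mul_comm t y, h.mul_comm t z, h.mul_comm x (y * z), h.mul_comm x (y * t),
    h.mul_comm x (z * t), h.mul_comm y (z * t), h.mul_comm (z * t) (x * y),
    h.mul_comm (y * t) (x * z), h.mul_comm (y * z) (x * t), hq a k b c, hq a k b d, hq a k c d,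
    hq b k c d, add_mul, smul_mul_assoc]
  module

/-- Since w kills e, only (ww)e = γe survives among the three monomials. -/
theorem coeff₃_eq_zero (h : SpinFrame F γ n m o w e f) (hγ : γ ≠ 0) {p : ι → ι → ι → F}
    (H : ∀ a b c, ∀ x y z : A, multi₃ p a b c x y z = 0) (a b c : ι) : p a b c = 0 := by
  have := H a b c w w e
  rw [h.multi₃_wwe, smul_eq_zero] at this
  simpa [hγ, h.e_ne_zero] using this

variable [SMulCommClass F A A]

theorem multi₄_eeww (h : SpinFrame F γ n m o w e f) (p q : ι → ι → ι → ι → F) (i j k l : ι) :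
    multi₄ p q i j k l e e w w =
      (-n * γ * (3 * γ * (p i j k l + p i j l k + q i j k l) +
        (1 + 3 * γ) * (p k l i j + p k l j i))) • o +
      (n * γ * (p k l i j + p k l j i - 2 * (p i j k l + p i j l k + q i j k l))) • w := by
  simp only [multi₄, multi₃, h.one_mul, h.mul_one, h.w_mul_w, h.w_mul_e, h.e_mul_e, h.e_mul_w,
    smul_mul_assoc, mul_smul_comm,
    add_mul, mul_add, sub_mul, mul_sub, smul_add, smul_sub, smul_zero, zero_mul, mul_zero,
    add_zero, zero_add, smul_smul]
  module

theorem multi₅_eefww (h : SpinFrame F γ n m o w e f) (p q r : ι → ι → ι → ι → ι → F)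
    (a b c d d' : ι) :
    multi₅ p q r a b c d d' e e f w w =
      (-n * γ * ((1 + 3 * γ) * (r a b c d d' + r d d' c a b + p d d' a b c + p d d' b a c) +
        3 * γ * (q a b d d' c + p a b d d' c + p a b d' d c))) • f := by
  simp only [multi₅, multi₄, multi₃, h.one_mul, h.mul_one, h.w_mul_w, h.w_mul_e, h.w_mul_f,
    h.e_mul_f, h.e_mul_e, h.e_mul_w, h.f_mul_w, h.f_mul_e, smul_mul_assoc,
    mul_smul_comm, add_mul, mul_add, sub_mul, mul_sub, smul_add, smul_sub, smul_zero, zero_mul,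
    mul_zero, add_zero, zero_add, smul_smul]
  module

theorem multi₅_eeffw (h : SpinFrame F γ n m o w e f) (p q r : ι → ι → ι → ι → ι → F)
    (a b c d k : ι) :
    multi₅ p q r a b c d k e e f f w =
      (-n * m * γ * ((1 + 3 * γ) * (p a b k c d + p a b k d c + p c d k a b + p c d k b a +
          p a b c d k + p a b d c k + p c d a b k + p c d b a k) +
        (1 + 6 * γ) * (r a b k c d + r c d k a b + q a b c d k))) • o +
      (n * m * γ * (p a b k c d + p a b k d c + p c d k a b + p c d k b a +
        (1 + 9 * γ) * (r a b k c d + r c d k a b + q a b c d k) +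
        (3 + 9 * γ) * (p a b c d k + p a b d c k + p c d a b k + p c d b a k))) • w := by
  simp only [multi₅, multi₄, multi₃, h.one_mul, h.mul_one, h.w_mul_w, h.w_mul_e, h.w_mul_f,
    h.e_mul_f, h.e_mul_e, h.f_mul_f, h.e_mul_w, h.f_mul_w, smul_mul_assoc,
    mul_smul_comm, add_mul, mul_add, sub_mul, mul_sub, smul_add, smul_sub, smul_zero, zero_mul,
    mul_zero, add_zero, zero_add, smul_smul]
  module

theorem multi₅_eefff (h : SpinFrame F γ n m o w e f) (p q r : ι → ι → ι → ι → ι → F)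
    (a b c d k : ι) :
    multi₅ p q r a b c d k e e f f f =
      (n * m * ((1 + 3 * γ) ^ 2 * (r a b k c d + r c d k a b + r a b d c k + r c k d a b +
          r a b c d k + r d k c a b +
          p a b c d k + p a b d c k + p c d a b k + p c d b a k +
          p a b c k d + p a b k c d + p c k a b d + p c k b a d +
          p a b d k c + p a b k d c + p d k a b c + p d k b a c) +
        (1 + 7 * γ + 9 * γ ^ 2) * (q a b c d k + q a b c k d + q a b d k c))) • f := by
  simp only [multi₅, multi₄, multi₃, h.one_mul, h.mul_one, h.w_mul_w, h.w_mul_e, h.w_mul_f,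
    h.e_mul_f, h.e_mul_e, h.f_mul_f, h.f_mul_w, h.f_mul_e, smul_mul_assoc,
    mul_smul_comm, add_mul, mul_add, sub_mul, mul_sub, smul_add, smul_sub, smul_zero, zero_mul,
    mul_zero, add_zero, zero_add, smul_smul]
  module

/-- The tuple eeww forces `q` = 0 and antisymmetry of `p` in its last two labels; insertion of the
unit then gives antisymmetry in the first and third labels, which contradicts symmetry in the first
two unless `p` = 0. -/
theorem coeff₄_eq_zero [CharZero F] (h : SpinFrame F γ n m o w e f) (hγ : γ ≠ 0)
    (hγ' : 2 + 9 * γ ≠ 0) {p q : ι → ι → ι → ι → F} (hp : ∀ a b c d, p a b c d = p b a c d)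
    (hq : ∀ a b c d, q a b c d = q c d a b)
    (H : ∀ a b c d, ∀ x y z t : A, multi₄ p q a b c d x y z t = 0) :
    (∀ a b c d, p a b c d = 0) ∧ ∀ a b c d, q a b c d = 0 := by
  have h1 : ∀ a b c d, p a b c d + p a b d c + q a b c d = 0 ∧ p c d a b + p c d b a = 0 := by
    intro a b c d
    have := H a b c d e e w w
    rw [h.multi₄_eeww] at this
    obtain ⟨h0, h1⟩ := h.indep _ _ this
    have h0 := (mul_eq_zero.1 h0).resolve_left (mul_ne_zero (neg_ne_zero.2 h.n_ne_zero) hγ)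
    have h1 := (mul_eq_zero.1 h1).resolve_left (mul_ne_zero h.n_ne_zero hγ)
    -- With X this sum and Y = `p c d a b + p c d b a`, the components at 1 and w read 3γX + (1 +
    -- 3γ)Y = 0 and Y = 2X. Elimination of Y gives (2 + 9γ)X = 0.
    have h2 : p a b c d + p a b d c + q a b c d = 0 := by
      refine (mul_eq_zero.1 ?_).resolve_left hγ'
      linear_combination h0 - (1 + 3 * γ) * h1
    exact ⟨h2, by linear_combination h1 + 2 * h2⟩
  have h2 : ∀ a b c d, q a b c d = 0 := fun a b c d => by
    linear_combination (h1 a b c d).1 - (h1 c d a b).2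
  refine ⟨fun a b c d => ?_, h2⟩
  have h4 : ∀ a b c d, p a d b c + p b d a c = 0 := fun a b c d => by
    have := h.coeff₃_eq_zero hγ
      (p := fun a b c => p a d b c + p b d a c + p a b d c + p a b c d + q a b c d)
      (fun a b c x y z => by rw [← h.multi₄_one hq]; exact H a b c d x y z o) a b c
    linear_combination this - (h1 c d a b).2 - h2 a b c d
  -- On the first three labels (12) acts as 1 and (13) as -1. Both (12)(13)(12) and (13)(12)(13)
  -- equal (23), so (23) acts as -1 and as 1, and 2p = 0.
  refine (mul_eq_zero.1 ?_).resolve_left (two_ne_zero (α := F))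
  linear_combination h4 a c d b - h4 b a d c + h4 c b d a - hp c b a d - hp c a b d - hp b a c d

/-- The two insertion equations say that the degree-four identity obtained by setting the last
variable equal to 1 has zero coefficients. The value at eeffw lies in the span of 1 and w, which is
why it yields two equations. -/
theorem coeffEquations [CharZero F] (h : SpinFrame F γ n m o w e f) (hγ : γ ≠ 0)
    (hγ' : 2 + 9 * γ ≠ 0) {p q r : ι → ι → ι → ι → ι → F}
    (p_comm : ∀ a b c d e, p a b c d e = p b a c d e)
    (q_comm : ∀ a b c d e, q a b c d e = q b a c d e)
    (q_swap : ∀ a b c d e, q a b c d e = q c d a b e)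
    (r_comm : ∀ a b c d e, r a b c d e = r b a c d e)
    (r_comm' : ∀ a b c d e, r a b c d e = r a b c e d)
    (H : ∀ a b c d k, ∀ x y z t u : A, multi₅ p q r a b c d k x y z t u = 0) :
    CoeffEquations γ p q r := by
  have hn := h.n_ne_zero
  have hm := h.m_ne_zero
  have h4 := fun k => h.coeff₄_eq_zero hγ hγ' (p := fun a b c d =>
      p a k b c d + p b k a c d + p a b k c d + p a b c k d + p a b c d k + q a b c k d + r a b c d k)
    (q := fun a b c d => r a k b c d + r b k a c d + r a b k c d + r c k d a b + r d k c a b +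
      r c d k a b + q a b c d k)
    (fun a b c d => by
      linear_combination p_comm a b k c d + p_comm a b c k d + p_comm a b c d k + q_comm a b c k d +
        r_comm a b c d k)
    (fun a b c d => by linear_combination q_swap a b c d k)
    (fun a b c d x y z t => by rw [← h.multi₅_one q_swap]; exact H a b c d k x y z t o)
  have h45 := fun a b c d k => h.indep _ _ <|
    (h.multi₅_eeffw p q r a b c d k).symm.trans (H a b c d k e e f f w)
  exact {
    p_comm := p_comm
    q_comm := q_comm
    q_swap := q_swap
    r_comm := r_comm
    r_comm' := r_comm'
    insert₁ := fun a b c d k => (h4 k).1 a b c d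
    insert₂ := fun a b c d k => (h4 k).2 a b c d
    eefww := fun a b c d d' => by
      have := H a b c d d' e e f w w
      rw [h.multi₅_eefww, smul_eq_zero] at this
      simpa [hn, hγ, h.f_ne_zero] using this
    eeffw₀ := fun a b c d k => by simpa [hn, hm, hγ] using (h45 a b c d k).1
    eeffw₁ := fun a b c d k => by simpa [hn, hm, hγ] using (h45 a b c d k).2
    eefff := fun a b c d k => by
      have := H a b c d k e e f f f
      rw [h.multi₅_eefff, smul_eq_zero] at this
      simpa [hn, hm, h.f_ne_zero] using this }

end SpinFrame

end Evaluation

/-! ### Solution of the linear equations for the coefficients of degree five. -/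

section LinearAlgebra

variable {F ι : Type*} [Field F] {γ : F}

/-- A function on the partitions of five points into two pairs and a single point, i.e. on the
perfect matchings of six points, is zero if it is an eigenvector of the collinearity graph
with eigenvalue `(2 + 6γ) / γ`, and the sum of its values over each collinear triple corresponding
to a pair of the five points is annihilated by `27γ² + 14γ + 2`. -/
theorem eq_zero_of_collinearity [CharZero F] (hγ : 2 + 9 * γ ≠ 0) {R : ι → ι → ι → ι → ι → F}
    (hc : ∀ a b c d e, R a b c d e = R b a c d e) (hs : ∀ a b c d e, R a b c d e = R c d a b e)
    (hM : ∀ a b c d e, (2 + 6 * γ) * R a b c d e = γ * (R a b c e d + R a b d e c + R c d a e b +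
      R c d b e a + R a c b d e + R a d b c e))
    (hK : ∀ a b c d e, (27 * γ ^ 2 + 14 * γ + 2) *
      (R a b c d e + R a b c e d + R a b d e c) = 0) (a b c d e : ι) : R a b c d e = 0 := by
  -- The matchings of six points form the generalized quadrangle of order (2,2), whose collinearity
  -- graph has eigenvalues 6, 1, -3. For γ ≠ 0, (2 + 6γ)/γ is never 6, is -3 only if 2 + 9γ = 0, and
  -- is 1 only if 2 + 5γ = 0; only this last case needs `hK`.
  by_cases h5 : 2 + 5 * γ = 0
  · have hL : ∀ a b c d e, R a b c d e + R a b c e d + R a b d e c = 0 := by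
      intro a b c d e
      refine (mul_eq_zero.1 (hK a b c d e)).resolve_left fun h0 => ?_
      -- At γ = -2/5 the polynomial 27γ² + 14γ + 2 takes the value 18/25.
      have : (18 : F) = 0 := by linear_combination 25 * h0 - (27 * 5 * γ + 16) * h5
      norm_num at this
    -- The line sums through `ab` and through `cd` vanish, so `hM` becomes (2 + 8γ)R = γ(R' + R''),
    -- where R, R', R'' are the values at the three pairings of a, b, c, d. Subtracting two such
    -- equations gives (2 + 9γ)(R - R') = 0.
    have hV : ∀ a b c d e, R a b c d e - R a c b d e = 0 := by
      intro a b c d e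
      refine (mul_eq_zero.1 ?_).resolve_left hγ
      linear_combination
        (1) * (hM a b c d e) + ((-1)) * (hM a c b d e) + (1 * γ) * (hL a b c d e + hL c d a b e + hs b
        d a c e) + ((-1) * γ) * (hL a c b d e + hL b d a c e + hs a d c b e + hc c b a d e + hs b c a
        d e + hs c d a b e)
    refine (mul_eq_zero.1 ?_).resolve_left
      (fun h0 => ?_ : (2 + 6 * γ : F) ≠ 0)
    · linear_combination
        (1) * (hM a b c d e) + (1 * γ) * (hL a b c d e + hL c d a b e + hs a b d c e + hc d c a b e) +
        ((-1) * γ) * (hV a b c d e + hV a b d c e)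
    · have : (2 : F) = 0 := by linear_combination 6 * h5 - 5 * h0
      norm_num at this
  -- The adjacency matrix M satisfies M² + 2M - 3 = 3J with J the all-ones matrix, and summing `hM`
  -- over all matchings gives JR = 0. Hence (M - 1)(M + 3)R = 0; the combination is this computation
  -- with denominators cleared.
  · refine (mul_eq_zero.1 ?_).resolve_left (mul_ne_zero hγ h5)
    linear_combination
      (1 * γ + (3 / 2) * γ ^ 2) * (hM a b c e d + hM a b d e c + hM a e c d b + hM b e c d a + hM a
      c b d e + hM a d b c e) + (2 + 8 * γ + (3 / 2) * γ ^ 2) * (hM a b c d e) + ((3 / 2) * γ ^ 2) *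
      (hM a c b e d + hM a c d e b + hM a d b e c + hM a d c e b + hM a e b c d + hM a e b d c + hM
      b c d e a + hM b d c e a) + (1 * γ ^ 2 + 3 * γ ^ 3) * (hs a b e d c + hc e d a b c + hs a b e
      c d + hc e c a b d + hs a e c b d + hc c b a e d + hs a e d b c + hc d b a e c + hs a c e d b
      + hc e d a c b + hs a d e c b + hc e c a d b + hs b c e d a + hc e d b c a + hs b d e c a + hc
      e c b d a + hs a d c b e + hc c b a d e + hs a c d b e + hc d b a c e) + (1 * γ ^ 2 + (9 / 2)
      * γ ^ 3) * (hs d e a b c + hs c e a b d + hs b c a d e + hs b d a c e) + (2 * γ ^ 2 + (9 / 2)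
      * γ ^ 3) * (hs c e a d b + hs c e b d a + hs d e a c b + hs d e b c a + hs b c a e d + hs b d
      a e c) + (2 * γ ^ 2 + 3 * γ ^ 3) * (hs a b d c e + hc d c a b e) + (3 * γ ^ 2 + (9 / 2) * γ ^
      3) * (hs c d a b e) + (1 * γ ^ 2 + (3 / 2) * γ ^ 3) * (hs c d e b a + hc e b c d a + hs b e c
      a d + hc c a b e d + hs b e d a c + hc d a b e c + hs c d b a e + hc b a c d e + hs c d e a b
      + hc e a c d b) + (2 * γ + 8 * γ ^ 2 + (9 / 2) * γ ^ 3) * (hs c d a e b + hs c d b e a) + ((9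
      / 2) * γ ^ 3) * (hs b e a d c + hs b e a c d) + (3 * γ ^ 3) * (hs a c e b d + hc e b a c d +
      hs b e d c a + hc d c b e a + hs a d e b c + hc e b a d c + hs a e d c b + hc d c a e b) + ((3
      / 2) * γ ^ 3) * (hs d e c b a + hc c b d e a + hs c e d b a + hc d b c e a + hs b c d a e + hc
      d a b c e + hs b c e a d + hc e a b c d + hs d e b a c + hc b a d e c + hs d e c a b + hc c a
      d e b + hs b d c a e + hc c a b d e + hs b d e a c + hc e a b d c + hs c e b a d + hc b a c e
      d + hs c e d a b + hc d a c e b)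

namespace CoeffEquations

variable {p q r : ι → ι → ι → ι → ι → F}

/-- The equation from eefww and its image under exchange of the pairs `ab`, `cd` show that `p a b c
d e + p a b d c e` is invariant under that exchange. The two components of eeffw then determine it.
-/
theorem eq_sum_sum (h : CoeffEquations γ p q r) (hγ : 2 + 9 * γ ≠ 0) (a b c d e : ι) :
    p a b c d e + p a b d c e = r a b e c d + r c d e a b ∧
      (2 + 9 * γ) * (r a b e c d + r c d e a b) + 3 * γ * q a b c d e = 0 := by
  have h1 := h.eefww a b e c d
  have h2 := h.eefww c d e a b
  have h3 := h.eeffw₀ a b c d e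
  have h4 := h.eeffw₁ a b c d e
  have hs : p c d a b e + p c d b a e = p a b c d e + p a b d c e := by
    linear_combination h1 - h2 - 3 * γ * h.q_swap a b c d e
  have h5 : 2 * (1 + 3 * γ) * (p a b c d e + p a b d c e) +
      3 * γ * (r a b e c d + r c d e a b + q a b c d e) = 0 := by
    refine (mul_eq_zero.1 ?_).resolve_left hγ
    linear_combination (1 + 3 * γ) * h4 - h3 -
      ((1 + 3 * γ) * (3 + 9 * γ) - (1 + 3 * γ)) * hs
  have h6 : p a b c d e + p a b d c e = r a b e c d + r c d e a b := by
    linear_combination h5 - h1 + (1 + 3 * γ) * hs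
  exact ⟨h6, by linear_combination h5 - 2 * (1 + 3 * γ) * h6⟩

variable [CharZero F]

/-- With R(ab|cd|e) = `r a b e c d + r c d e a b`, the long bracket is the sum of R over the six
matchings collinear with ab|cd|e. Only the insertion equations, the symmetries and `hs` enter, so γ
does not appear. -/
theorem q_eq (h : CoeffEquations γ p q r)
    (hs : ∀ a b c d e, p a b c d e + p a b d c e = r a b e c d + r c d e a b) (a b c d e : ι) :
    q a b c d e + (r a b e c d + r c d e a b) + 1 / 3 *
      ((r a b d c e + r c e d a b) + (r a b c d e + r d e c a b) + (r c d b a e + r a e b c d) +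
       (r c d a b e + r b e a c d) + (r a c e b d + r b d e a c) + (r a d e b c + r b c e a d)) =
      0 := by
  linear_combination
    (1 / 6) * (h.insert₁ c d b e a + h.insert₁ a b d e c + h.insert₁ c d a e b + h.insert₁ a b c e
    d + hs b c d e a + hs b d c e a + hs b c a e d + hs a d b e c + hs a c b e d + hs b d a e c +
    hs a d c e b + hs a c d e b) + (-1 / 12) * (h.insert₁ a c e b d + h.insert₁ b d e a c +
    h.insert₁ b d e c a + h.insert₁ b c e d a + h.insert₁ a d e c b + h.insert₁ a c e d b +
    h.insert₁ b c e a d + h.insert₁ a d e b c + h.r_comm b a d c e + h.r_comm d a b c e + h.r_comm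
    c a e b d + h.r_comm e a c b d + h.r_comm d b a c e + h.r_comm c b e a d + h.r_comm e b c a d
    + h.r_comm e d a b c + h.r_comm e c a b d + h.r_comm d c b a e + h.r_comm c b a d e + h.r_comm
    d b e a c + h.r_comm e b d a c + h.r_comm b a c d e + h.r_comm c a b d e + h.r_comm d a e b c
    + h.r_comm e a d b c + h.r_comm d c a b e + h.r_comm e c b a d + h.r_comm e d b a c) + (1 / 3)
    * (h.insert₂ a b c d e) + (1 / 12) * (h.insert₂ b d c e a + h.insert₂ a d c e b + h.insert₂ a
    e b c d + h.insert₂ a e b d c + h.insert₂ a c d e b + h.insert₂ b c d e a + h.insert₂ a d b e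
    c + h.insert₂ a c b e d + h.q_swap a c e d b + h.q_comm e d a c b + h.q_swap d e a c b +
    h.p_comm d c b e a + h.q_swap b d e c a + h.q_comm e c b d a + h.q_swap c e b d a + h.p_comm b
    a d e c + h.p_comm d a b e c + h.q_swap b d e a c + h.q_comm e a b d c + h.r_comm' b d e c a +
    h.p_comm b a c e d + h.p_comm c a b e d + h.q_swap b c e a d + h.q_comm e a b c d + h.r_comm'
    b c e d a + h.p_comm d b a e c + h.q_swap a d e b c + h.q_comm e b a d c + h.q_swap b e a d c
    + h.r_comm' a d e c b + h.p_comm c b a e d + h.q_swap a c e b d + h.q_comm e b a c d +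
    h.q_swap b e a c d + h.r_comm' a c e d b + h.q_swap b c e d a + h.q_comm e d b c a + h.q_swap
    d e b c a + h.p_comm d c a e b + h.q_swap a d e c b + h.q_comm e c a d b + h.q_swap c e a d b)
    + (-1 / 3) * (hs c d a b e + hs a b c d e + h.q_swap c d a b e) + (-1 / 6) * (hs b c a d e +
    hs a d b c e + hs a c b d e + hs b d a c e + h.p_comm c a d b e + h.p_comm d a c b e +
    h.q_swap c d b a e + h.q_comm b a c d e + h.r_comm' c d b e a + h.q_swap a b d c e + h.q_comm
    d c a b e + h.r_comm' a b d e c + h.p_comm c b d a e + h.p_comm d b c a e + h.r_comm' c d a e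
    b + h.r_comm' a b c e d)

/-- Eliminating `q` between `eq_sum_sum` and `q_eq` gives the eigenvector equation. Eliminating `p`
and `q` from `eefff` gives the condition on line sums, since (2 + 9γ)(1 + 7γ + 9γ²) - 9γ(1 + 3γ)² =
27γ² + 14γ + 2. -/
theorem r_add_r_eq_zero (h : CoeffEquations γ p q r) (hγ : 2 + 9 * γ ≠ 0)
    (a b c d e : ι) : r a b e c d + r c d e a b = 0 := by
  refine eq_zero_of_collinearity (R := fun a b c d e => r a b e c d + r c d e a b) hγ ?_ ?_ ?_ ?_
    a b c d e
  · intro a b c d e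
    linear_combination h.r_comm a b e c d + h.r_comm' c d e a b
  · intro a b c d e
    ring
  · intro a b c d e
    linear_combination (h.eq_sum_sum hγ a b c d e).2 -
      3 * γ * h.q_eq (fun a b c d e => (h.eq_sum_sum hγ a b c d e).1) a b c d e
  · intro a b c d e
    obtain ⟨h1, h1'⟩ := h.eq_sum_sum hγ a b c d e
    obtain ⟨h2, h2'⟩ := h.eq_sum_sum hγ a b c e d
    obtain ⟨h3, h3'⟩ := h.eq_sum_sum hγ a b d e c
    have h4 := (h.eq_sum_sum hγ c d a b e).1
    have h5 := (h.eq_sum_sum hγ c e a b d).1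
    have h6 := (h.eq_sum_sum hγ d e a b c).1
    linear_combination (1 + 7 * γ + 9 * γ ^ 2) * (h1' + h2' + h3') - 3 * γ * (h.eefff a b c d e) +
      3 * γ * (1 + 3 * γ) ^ 2 * (h1 + h2 + h3 + h4 + h5 + h6)

theorem q_eq_zero (h : CoeffEquations γ p q r) (hγ₀ : γ ≠ 0) (hγ : 2 + 9 * γ ≠ 0)
    (a b c d e : ι) : q a b c d e = 0 := by
  have h1 := (h.eq_sum_sum hγ a b c d e).2
  rw [h.r_add_r_eq_zero hγ] at h1
  simpa [hγ₀] using h1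

theorem p_antisymm (h : CoeffEquations γ p q r) (hγ : 2 + 9 * γ ≠ 0)
    (a b c d e : ι) : p a b c d e + p a b d c e = 0 := by
  rw [(h.eq_sum_sum hγ a b c d e).1, h.r_add_r_eq_zero hγ]

/-- The cyclic sum C turns out to be symmetric in all labels but the fourth, so for five given
labels it depends only on which of them stands fourth. Antisymmetry of `p` makes the sum of any four
of these five values zero. -/
theorem p_cyclic (h : CoeffEquations γ p q r) (hγ₀ : γ ≠ 0) (hγ : 2 + 9 * γ ≠ 0)
    (a b c d e : ι) : p a b c d e + p b c a d e + p c a b d e = 0 := by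
  have hp := h.p_antisymm hγ
  have hq := h.q_eq_zero hγ₀ hγ
  obtain ⟨C, hC⟩ : ∃ C : ι → ι → ι → ι → ι → F,
      ∀ a b c d e, C a b c d e = p a b c d e + p b c a d e + p c a b d e := ⟨_, fun _ _ _ _ _ => rfl⟩
  have hC₁ : ∀ a b c d e, C a b c d e = C b a c d e := fun a b c d e => by
    linear_combination hC a b c d e - hC b a c d e + h.p_comm a b c d e + h.p_comm b c a d e +
      h.p_comm c a b d e
  have hC₂ : ∀ a b c d e, C a b c d e = C b c a d e := fun a b c d e => by
    linear_combination hC a b c d e - hC b c a d e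
  have hC₃ : ∀ a b c d e, C a b c d e = C a b e d c := fun a b c d e => by
    linear_combination hC a b c d e - hC a b e d c + h.insert₁ a b d e c - h.insert₁ a b d c e +
      h.p_comm c a b d e - h.p_comm e a b d c - hq a b d c e + hq a b d e c - h.r_comm' a b d e c
  have hS : ∀ a b c d e, C a b c d e + C a b d c e + C a c d b e + C b c d a e = 0 :=
    fun a b c d e => by
    linear_combination hC a b c d e + hC a b d c e + hC a c d b e + hC b c d a e +
      hp a b c d e + hp b c a d e + hp c a b d e + hp b d a c e + hp d a b c e + hp c d a b e +
      h.p_comm a c d b e + h.p_comm d b c a e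
  rw [← hC]
  -- If any four of five values sum to zero, each value equals the total S; adding the four sums
  -- that contain a given value g and subtracting three times the fifth gives 4g = 0.
  refine (mul_eq_zero.1 ?_).resolve_left (by norm_num : (4 : F) ≠ 0)
  linear_combination
    (1) * (hS b c d e a + hS a c d e b + hS a b d e c + hS a b c d e) + ((-3)) * (hS a b c e d) +
    ((-1)) * (hC₃ b c d e a + hC₂ b c a e d + hC₃ b c e d a + hC₂ b c a d e + hC₃ b d e c a + hC₂
    b d a c e + hC₃ c d e b a + hC₂ c d a b e + hC₁ a c d e b + hC₃ c a d e b + hC₁ a c e d b +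
    hC₃ c a e d b + hC₁ a d e c b + hC₃ d a e c b + hC₃ c d e a b + hC₂ c d b a e + hC₃ a b d e c
    + hC₃ a b e d c + hC₁ a d e b c + hC₃ d a e b c + hC₁ b d e a c + hC₃ d b e a c) + ((-2)) *
    (hC₂ c a b e d + hC₂ c a b d e + hC₂ d a b c e + hC₂ d a c b e + hC₂ d b c a e) + (3) * (hC₃ a
    b e c d + hC₃ a c e b d + hC₃ b c e a d)

theorem r_eq (h : CoeffEquations γ p q r) (hγ₀ : γ ≠ 0) (hγ : 2 + 9 * γ ≠ 0)
    (a b c d e : ι) : r a b c d e = -(p a b c d e + p a b c e d) := by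
  linear_combination h.insert₁ a b c d e - h.q_eq_zero hγ₀ hγ a b c e d -
    h.p_cyclic hγ₀ hγ a e b c d + h.p_comm e b a c d + h.p_comm b a e c d

theorem p_link (h : CoeffEquations γ p q r) (hγ₀ : γ ≠ 0) (hγ : 2 + 9 * γ ≠ 0)
    (a b c d e : ι) :
    p a b e c d + p a b e d c + p c d e a b + p c d e b a = 0 := by
  linear_combination -h.r_add_r_eq_zero hγ a b c d e + h.r_eq hγ₀ hγ a b e c d +
    h.r_eq hγ₀ hγ c d e a b

/-- A decomposition of `p` into components which are alternating in three arguments and symmetric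
in the other two. -/
theorem exists_alternating (h : CoeffEquations γ p q r) (hγ₀ : γ ≠ 0) (hγ : 2 + 9 * γ ≠ 0) :
    ∃ T : ι → ι → ι → ι → ι → F, (∀ a b c d e, p a b c d e = T a b c d e + T b a c d e) ∧
      (∀ a b c d e, T a c b d e = -T a b c d e) ∧ (∀ a b c d e, T a c d b e = T a b c d e) ∧
      ∀ a b c d e, T e b c d a = T a b c d e := by
  have ha := h.p_antisymm hγ
  have hy := h.p_cyclic hγ₀ hγ
  have hl := h.p_link hγ₀ hγ
  have h12 : (12 : F) ≠ 0 := by norm_num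
  -- By antisymmetry of `p` in its third and fourth labels, this cyclic sum is alternating in `b`,
  -- `c`, `d`; it need not be symmetric in `a`, `e`.
  obtain ⟨t, ht⟩ : ∃ t : ι → ι → ι → ι → ι → F,
      ∀ a b c d e, t a b c d e = p a b c d e + p a c d b e + p a d b c e :=
    ⟨_, fun _ _ _ _ _ => rfl⟩
  -- The terms with `e` in front correct `t` to be symmetric in `a`, `e`. Cyclic invariance in `b`,
  -- `c`, `d` holds formally; the other three properties hold modulo the relations satisfied by `p`.
  obtain ⟨T, hT⟩ : ∃ T : ι → ι → ι → ι → ι → F, ∀ a b c d e, 12 * T a b c d e =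
      3 * t a b c d e + t e b c d a - t e a c d b - t e b a d c - t e b c a d :=
    ⟨fun a b c d e => (3 * t a b c d e + t e b c d a - t e a c d b - t e b a d c - t e b c a d) / 12,
      fun _ _ _ _ _ => mul_div_cancel₀ _ h12⟩
  simp only [ht] at hT
  refine ⟨T, fun a b c d e => ?_, fun a b c d e => ?_, fun a b c d e => ?_, fun a b c d e => ?_⟩
  · refine mul_left_cancel₀ h12 ?_
    rw [mul_add, hT, hT]
    linear_combination
      3 * (ha a b c d e + hy a b c d e + h.p_comm d a b c e) + -3 * (ha a c b d e + hy a b d c e +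
      ha b c a d e + h.p_comm b a c d e + h.p_comm c a b d e) + (ha a e b c d + ha a e b d c + ha d
      e a b c + ha b e a c d + ha b e a d c + ha c e a b d + h.p_comm e b a d c + h.p_comm e a d b c
      + h.p_comm e d b a c + h.p_comm e b c a d + h.p_comm e c a b d + h.p_comm e a b c d + h.p_comm
      e a b d c + h.p_comm e b d a c + h.p_comm e d a b c + h.p_comm e a c b d + h.p_comm e c b a d
      + h.p_comm e b a c d)
  · refine mul_left_cancel₀ h12 ?_
    rw [mul_neg, hT, hT]
    linear_combination
      -1 * (hl a b c e d + hl a d c e b + ha d e a c b + hl b d c e a + ha a e b c d + ha a e b d c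
      + ha d e a b c + ha a e c d b + ha b e a d c + ha b e a c d + h.p_comm e a c d b + h.p_comm e
      c d a b + h.p_comm e d a c b + h.p_comm e b a d c + h.p_comm e a d b c + h.p_comm e d b a c +
      h.p_comm e b c a d + h.p_comm e c a b d + h.p_comm e a b c d + h.p_comm e a b d c + h.p_comm e
      b d a c + h.p_comm e d a b c + h.p_comm e c a d b + h.p_comm e a d c b + h.p_comm e d c a b +
      h.p_comm e c b a d + h.p_comm e b a c d + h.p_comm e a c b d + h.p_comm d a b c e + h.p_comm d
      a b e c) + (hy a b d c e + ha b e c d a + hy a b d e c + ha d e b c a + h.p_comm e b c d a +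
      h.p_comm e c d b a + h.p_comm e d b c a + h.p_comm e c b d a + h.p_comm e b d c a + h.p_comm e
      d c b a) + 3 * (ha a d b c e + ha a b c d e + ha a c b d e) + 2 * (ha c e b d a)
  · refine mul_left_cancel₀ h12 ?_
    rw [hT, hT]
    ring
  · refine mul_left_cancel₀ h12 ?_
    rw [hT, hT]
    linear_combination -(
      (hl a b d e c + ha a b c d e + hy a b d e c + ha a b d e c + hl a c b e d + hy a c d e b + hl
      a c b d e + ha a d c e b + ha a d b c e + hy a c d b e + ha c e a d b + ha b e a c d + hy a b
      d c e + h.p_comm e b d a c + h.p_comm e b d c a) + -2 * (hl a b c e d + hl a d b e c +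
      h.p_comm e b c d a + h.p_comm e c d b a + h.p_comm e d b c a) + -1 * (ha a c d e b + ha d e a
      c b + hy b d e a c + hy b d e c a + hl b e c d a + hl b d c e a + ha d e b c a + h.p_comm e a
      c d b + h.p_comm e c d a b + h.p_comm e d a c b + h.p_comm e b a d c + h.p_comm e a d b c +
      h.p_comm e d b a c + h.p_comm e b c a d + h.p_comm e c a b d + h.p_comm e a b c d + h.p_comm d
      a b e c + h.p_comm d a c e b + h.p_comm d a c b e + h.p_comm d a b c e))

end CoeffEquations

end LinearAlgebra

/-! ### Averaging over the symmetries of a monomial. -/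

section Reindexing

variable {F ι A : Type*} [Field F] [Fintype ι] [AddCommGroup A] [Module F A] {n : ℕ}

theorem sum_smul_perm (σ : Equiv.Perm (Fin n)) (c : (Fin n → ι) → F) (m : (Fin n → ι) → A) :
    ∑ φ, c (φ ∘ σ) • m (φ ∘ σ) = ∑ φ, c φ • m φ :=
  (Equiv.arrowCongr σ.symm (Equiv.refl ι)).sum_comp fun φ => c φ • m φ

/-- Reindexing by a permutation that fixes the monomials moves only the coefficients, so each
coefficient may be replaced by its sum over `l`, at the cost of the factor `l.length`. -/
theorem length_smul_sum (l : List (Equiv.Perm (Fin n))) (c : (Fin n → ι) → F)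
    (m : (Fin n → ι) → A) (hm : ∀ φ, ∀ σ ∈ l, m (φ ∘ σ) = m φ) :
    (l.length : F) • ∑ φ, c φ • m φ = ∑ φ, (l.map fun σ : Equiv.Perm (Fin n) => c (φ ∘ ⇑σ)).sum • m φ := by
  induction l with
  | nil => simp
  | cons σ l ih =>
    have h : ∑ φ, c (φ ∘ σ) • m φ = ∑ φ, c φ • m φ := by
      rw [← sum_smul_perm σ c]
      exact Finset.sum_congr rfl fun φ _ => by rw [hm φ σ (by simp)]
    simp only [List.length_cons, List.map_cons, List.sum_cons, add_smul, Finset.sum_add_distrib, h,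
      ← ih fun φ σ hσ => hm φ σ (List.mem_cons_of_mem _ hσ), Nat.cast_add, Nat.cast_one, one_smul]
    abel

theorem sum_smul_eq_zero_of_symm [CharZero F] (l : List (Equiv.Perm (Fin n))) (hl : l ≠ [])
    {c : (Fin n → ι) → F} {m : (Fin n → ι) → A} (hm : ∀ φ, ∀ σ ∈ l, m (φ ∘ σ) = m φ)
    (hc : ∀ φ, (l.map fun σ : Equiv.Perm (Fin n) => c (φ ∘ ⇑σ)).sum = 0) : ∑ φ, c φ • m φ = 0 := by
  have h := length_smul_sum l c m hm
  simp only [hc, zero_smul, Finset.sum_const_zero] at h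
  exact (smul_eq_zero.1 h).resolve_left (by simpa using hl)

/-- Meant for the dihedral group of order 8 of symmetries of (x₀x₁)(x₂x₃), with `σ`, `τ` flipping
the pairs and `ρ` exchanging them. -/
theorem sum_smul_eq_zero_of_pairs [CharZero F] (σ τ ρ : Equiv.Perm (Fin n))
    {c : (Fin n → ι) → F} {m : (Fin n → ι) → A} (hσ : ∀ φ, m (φ ∘ σ) = m φ)
    (hτ : ∀ φ, m (φ ∘ τ) = m φ) (hρ : ∀ φ, m (φ ∘ ρ) = m φ)
    (hc : ∀ φ, c φ + c (φ ∘ σ) + c (φ ∘ τ) + c (φ ∘ σ ∘ τ) + c (φ ∘ ρ) + c (φ ∘ ρ ∘ σ) +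
      c (φ ∘ ρ ∘ τ) + c (φ ∘ ρ ∘ σ ∘ τ) = 0) : ∑ φ, c φ • m φ = 0 := by
  refine sum_smul_eq_zero_of_symm [1, σ, τ, σ * τ, ρ, ρ * σ, ρ * τ, ρ * σ * τ] (by simp)
    (fun φ => ?_) fun φ => ?_
  · simp only [List.forall_mem_cons, Equiv.Perm.coe_mul, Equiv.Perm.coe_one, ← Function.comp_assoc,
      hσ, hτ, hρ, Function.comp_id]
    simp
  · simpa [Function.comp_assoc, ← add_assoc] using hc φ

end Reindexing

/-! ### Vanishing of the normal forms in commutative algebras with three associators. -/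

section ThreeAssociators

variable {F ι A : Type*} [Field F] [CharZero F] [Fintype ι] [NonUnitalNonAssocRing A] [Module F A]

theorem sum_shape₂_eq_zero (hcomm : ∀ x y : A, x * y = y * x) (x : ι → A)
    (p : (Fin 2 → ι) → F) (hp : ∀ a b, p ![a, b] + p ![b, a] = 0) :
    ∑ φ, p φ • (x (φ 0) * x (φ 1)) = 0 := by
  have e : ∀ φ : Fin 2 → ι, φ = ![φ 0, φ 1] := fun φ => by ext i; fin_cases i <;> rfl
  refine sum_smul_eq_zero_of_symm [1, Equiv.swap 0 1] (by simp) (fun φ => ?_) fun φ => ?_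
  · simp [hcomm (x (φ 1))]
  · simpa [e (φ ∘ Equiv.swap 0 1), ← e φ] using hp (φ 0) (φ 1)

theorem sum_shape₃_eq_zero (hcomm : ∀ x y : A, x * y = y * x) (x : ι → A)
    (p : (Fin 3 → ι) → F) (hp : ∀ a b c, p ![a, b, c] + p ![b, a, c] = 0) :
    ∑ φ, p φ • (x (φ 0) * x (φ 1) * x (φ 2)) = 0 := by
  have e : ∀ φ : Fin 3 → ι, φ = ![φ 0, φ 1, φ 2] := fun φ => by ext i; fin_cases i <;> rfl
  refine sum_smul_eq_zero_of_symm [1, Equiv.swap 0 1] (by simp) (fun φ => ?_) fun φ => ?_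
  · simp [hcomm (x (φ 1)), Equiv.swap_apply_def]
  · simpa [e (φ ∘ Equiv.swap 0 1), ← e φ, Equiv.swap_apply_def] using hp (φ 0) (φ 1) (φ 2)

theorem sum_shape₄_eq_zero (hcomm : ∀ x y : A, x * y = y * x) (x : ι → A)
    (p q : (Fin 4 → ι) → F) (hp : ∀ a b c d, p ![a, b, c, d] + p ![b, a, c, d] = 0)
    (hq : ∀ a b c d, symmPairs (fun a b c d => q ![a, b, c, d]) a b c d = 0) :
    ∑ φ, p φ • (x (φ 0) * x (φ 1) * x (φ 2) * x (φ 3)) +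
      ∑ φ, q φ • (x (φ 0) * x (φ 1) * (x (φ 2) * x (φ 3))) = 0 := by
  have e : ∀ φ : Fin 4 → ι, φ = ![φ 0, φ 1, φ 2, φ 3] := fun φ => by ext i; fin_cases i <;> rfl
  have h₁ : ∑ φ, p φ • (x (φ 0) * x (φ 1) * x (φ 2) * x (φ 3)) = 0 := by
    refine sum_smul_eq_zero_of_symm [1, Equiv.swap 0 1] (by simp) (fun φ => ?_) fun φ => ?_
    · simp [hcomm (x (φ 1)), Equiv.swap_apply_def]
    · simpa [e (φ ∘ Equiv.swap 0 1), ← e φ, Equiv.swap_apply_def] using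
        hp (φ 0) (φ 1) (φ 2) (φ 3)
  have h₂ : ∑ φ, q φ • (x (φ 0) * x (φ 1) * (x (φ 2) * x (φ 3))) = 0 := by
    refine sum_smul_eq_zero_of_pairs (Equiv.swap 0 1) (Equiv.swap 2 3)
      (Equiv.swap 0 2 * Equiv.swap 1 3) (fun φ => ?_) (fun φ => ?_) (fun φ => ?_) fun φ => ?_
    · simp [hcomm (x (φ 1)), Equiv.swap_apply_def]
    · simp [hcomm (x (φ 3)), Equiv.swap_apply_def]
    · simp [hcomm (x (φ 0) * x (φ 1)), Equiv.swap_apply_def]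
    · rw [← hq (φ 0) (φ 1) (φ 2) (φ 3)]
      have (ψ : Fin 4 → ι) {a b c d : ι} (ha : ψ 0 = a) (hb : ψ 1 = b) (hc : ψ 2 = c)
          (hd : ψ 3 = d) : q ψ = q ![a, b, c, d] := by rw [e ψ, ha, hb, hc, hd]
      unfold symmPairs
      repeat' refine congrArg₂ HAdd.hAdd ?_ ?_
      all_goals exact this _ rfl rfl rfl rfl
  rw [h₁, h₂, add_zero]

/-- The weight `T` is invariant under the group of order 6 generated by the 3-cycle of the middle
labels and the exchange of the outer ones. The sum of the double associator over this group is the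
linearized identity. -/
theorem sum_associator_eq_zero (h : ∀ a b c d : A, threeAssociatorsExpr a b c d = 0) (x : ι → A)
    (T : ι → ι → ι → ι → ι → F) (hT₁ : ∀ a b c d e, T a c d b e = T a b c d e)
    (hT₂ : ∀ a b c d e, T e b c d a = T a b c d e) :
    ∑ φ : Fin 5 → ι, T (φ 0) (φ 1) (φ 2) (φ 3) (φ 4) •
      associator (associator (x (φ 1)) (x (φ 0)) (x (φ 2))) (x (φ 3)) (x (φ 4)) = 0 := by
  have hlin : ∀ a b c d e : A,
      associator (associator b a c) d e + associator (associator c a d) b e +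
      associator (associator d a b) c e + (associator (associator b e c) d a +
      associator (associator c e d) b a + associator (associator d e b) c a) = 0 := by
    intro a b c d e
    -- Linearization in the repeated variable.
    calc _ = threeAssociatorsExpr b (a + e) c d - threeAssociatorsExpr b a c d -
          threeAssociatorsExpr b e c d := by
          simp only [threeAssociatorsExpr, associator, mul_add, add_mul, sub_mul]
          abel
      _ = 0 := by rw [h, h, h, sub_zero, sub_zero]
  obtain ⟨V, hV⟩ : ∃ V : (Fin 5 → ι) → A, ∀ φ, V φ =
      associator (associator (x (φ 1)) (x (φ 0)) (x (φ 2))) (x (φ 3)) (x (φ 4)) :=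
    ⟨_, fun _ => rfl⟩
  have key : ∀ σ : Equiv.Perm (Fin 5), (∀ φ : Fin 5 → ι,
      T (φ (σ 0)) (φ (σ 1)) (φ (σ 2)) (φ (σ 3)) (φ (σ 4)) =
        T (φ 0) (φ 1) (φ 2) (φ 3) (φ 4)) →
      ∑ φ : Fin 5 → ι, T (φ 0) (φ 1) (φ 2) (φ 3) (φ 4) • V φ =
        ∑ φ : Fin 5 → ι, T (φ 0) (φ 1) (φ 2) (φ 3) (φ 4) • V (φ ∘ σ) := fun σ hσ => by
    rw [← sum_smul_perm σ]
    exact Finset.sum_congr rfl fun φ _ => by simp only [Function.comp_apply, hσ]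
  have h₁ := key (Equiv.swap 1 2 * Equiv.swap 2 3) fun φ => hT₁ _ _ _ _ _
  have h₂ := key (Equiv.swap 2 3 * Equiv.swap 1 2) fun φ => (hT₁ _ _ _ _ _).symm
  have h₃ := key (Equiv.swap 0 4) fun φ => hT₂ _ _ _ _ _
  have h₄ := key (Equiv.swap 1 2 * Equiv.swap 2 3 * Equiv.swap 0 4) fun φ =>
    (hT₂ _ _ _ _ _).trans (hT₁ _ _ _ _ _)
  have h₅ := key (Equiv.swap 2 3 * Equiv.swap 1 2 * Equiv.swap 0 4) fun φ =>
    (hT₂ _ _ _ _ _).trans (hT₁ _ _ _ _ _).symm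
  simp only [← hV]
  refine (smul_eq_zero.1 ?_).resolve_left (by norm_num : (6 : F) ≠ 0)
  calc (6 : F) • ∑ φ : Fin 5 → ι, T (φ 0) (φ 1) (φ 2) (φ 3) (φ 4) • V φ
    _ = ∑ φ : Fin 5 → ι, T (φ 0) (φ 1) (φ 2) (φ 3) (φ 4) • (V φ +
        V (φ ∘ (Equiv.swap 1 2 * Equiv.swap 2 3 : Equiv.Perm (Fin 5))) +
        V (φ ∘ (Equiv.swap 2 3 * Equiv.swap 1 2 : Equiv.Perm (Fin 5))) +
        (V (φ ∘ Equiv.swap 0 4) +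
        V (φ ∘ (Equiv.swap 1 2 * Equiv.swap 2 3 * Equiv.swap 0 4 : Equiv.Perm (Fin 5))) +
        V (φ ∘ (Equiv.swap 2 3 * Equiv.swap 1 2 * Equiv.swap 0 4 : Equiv.Perm (Fin 5))))) := by
      simp only [smul_add, Finset.sum_add_distrib, ← h₁, ← h₂, ← h₃, ← h₄, ← h₅]
      module
    _ = 0 := Finset.sum_eq_zero fun φ _ => by
      simp only [hV]
      exact (congrArg _ (hlin (x (φ 0)) (x (φ 1)) (x (φ 2)) (x (φ 3)) (x (φ 4)))).trans
        (smul_zero _)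

/-- The hypothesis on `r` makes the total one half of ΣPW, where W = (x₀x₁x₂, x₃, x₄). By
commutativity ((x₁,x₀,x₂),x₃,x₄) is W minus its image under exchange of x₁ and x₂, so antisymmetry
of `T` turns the weighted sum of double associators into 2ΣTW, which is also ΣPW. -/
theorem sum_shape₅_eq_zero (hcomm : ∀ x y : A, x * y = y * x)
    (h : ∀ a b c d : A, threeAssociatorsExpr a b c d = 0) (x : ι → A)
    (p q r : (Fin 5 → ι) → F) {P T : ι → ι → ι → ι → ι → F}
    (hp : ∀ a b c d e, p ![a, b, c, d, e] + p ![b, a, c, d, e] = P a b c d e)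
    (hq : ∀ a b c d e, symmPairs (fun a b c d => q ![a, b, c, d, e]) a b c d = 0)
    (hr : ∀ a b c d e, r ![a, b, c, d, e] + r ![b, a, c, d, e] + r ![a, b, c, e, d] +
      r ![b, a, c, e, d] = -(P a b c d e + P a b c e d))
    (hP : ∀ a b c d e, P a b c d e = T a b c d e + T b a c d e)
    (hT₀ : ∀ a b c d e, T a c b d e = -T a b c d e)
    (hT₁ : ∀ a b c d e, T a c d b e = T a b c d e)
    (hT₂ : ∀ a b c d e, T e b c d a = T a b c d e) :
    ∑ φ, p φ • (x (φ 0) * x (φ 1) * x (φ 2) * x (φ 3) * x (φ 4)) +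
      ∑ φ, q φ • (x (φ 0) * x (φ 1) * (x (φ 2) * x (φ 3)) * x (φ 4)) +
      ∑ φ, r φ • (x (φ 0) * x (φ 1) * x (φ 2) * (x (φ 3) * x (φ 4))) = 0 := by
  have e : ∀ φ : Fin 5 → ι, φ = ![φ 0, φ 1, φ 2, φ 3, φ 4] := fun φ => by
    ext i; fin_cases i <;> rfl
  have h₁ : (2 : F) • ∑ φ, p φ • (x (φ 0) * x (φ 1) * x (φ 2) * x (φ 3) * x (φ 4)) =
      ∑ φ : Fin 5 → ι, P (φ 0) (φ 1) (φ 2) (φ 3) (φ 4) •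
        (x (φ 0) * x (φ 1) * x (φ 2) * x (φ 3) * x (φ 4)) := by
    refine (length_smul_sum [1, Equiv.swap 0 1] p _ fun φ => ?_).trans
      (Finset.sum_congr rfl fun φ _ => ?_)
    · simp [hcomm (x (φ 1)), Equiv.swap_apply_def]
    · simp [← hp, e (φ ∘ Equiv.swap 0 1), ← e φ, Equiv.swap_apply_def]
  have h₂ : ∑ φ, q φ • (x (φ 0) * x (φ 1) * (x (φ 2) * x (φ 3)) * x (φ 4)) = 0 := by
    refine sum_smul_eq_zero_of_pairs (Equiv.swap 0 1) (Equiv.swap 2 3)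
      (Equiv.swap 0 2 * Equiv.swap 1 3) (fun φ => ?_) (fun φ => ?_) (fun φ => ?_) fun φ => ?_
    · simp [hcomm (x (φ 1)), Equiv.swap_apply_def]
    · simp [hcomm (x (φ 3)), Equiv.swap_apply_def]
    · simp [hcomm (x (φ 0) * x (φ 1)), Equiv.swap_apply_def]
    · rw [← hq (φ 0) (φ 1) (φ 2) (φ 3) (φ 4)]
      have (ψ : Fin 5 → ι) {a b c d k : ι} (ha : ψ 0 = a) (hb : ψ 1 = b) (hc : ψ 2 = c)
          (hd : ψ 3 = d) (hk : ψ 4 = k) : q ψ = q ![a, b, c, d, k] := by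
        rw [e ψ, ha, hb, hc, hd, hk]
      unfold symmPairs
      repeat' refine congrArg₂ HAdd.hAdd ?_ ?_
      all_goals exact this _ rfl rfl rfl rfl rfl
  have h₃ : (4 : F) • ∑ φ, r φ • (x (φ 0) * x (φ 1) * x (φ 2) * (x (φ 3) * x (φ 4))) =
      (-2 : F) • ∑ φ : Fin 5 → ι, P (φ 0) (φ 1) (φ 2) (φ 3) (φ 4) •
        (x (φ 0) * x (φ 1) * x (φ 2) * (x (φ 3) * x (φ 4))) := by
    have h₄ := length_smul_sum [1, Equiv.swap 3 4]
      (fun φ : Fin 5 → ι => P (φ 0) (φ 1) (φ 2) (φ 3) (φ 4))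
      (fun φ => x (φ 0) * x (φ 1) * x (φ 2) * (x (φ 3) * x (φ 4)))
      fun φ => by simp [hcomm (x (φ 4)), Equiv.swap_apply_def]
    have h₅ := length_smul_sum
      [1, Equiv.swap 0 1, Equiv.swap 3 4, Equiv.swap 0 1 * Equiv.swap 3 4] r
      (fun φ => x (φ 0) * x (φ 1) * x (φ 2) * (x (φ 3) * x (φ 4)))
      fun φ => by simp [hcomm (x (φ 4)), hcomm (x (φ 1)), Equiv.swap_apply_def]
    rw [neg_smul]
    refine h₅.trans (Eq.trans ?_ (congrArg Neg.neg h₄.symm))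
    rw [← Finset.sum_neg_distrib]
    refine Finset.sum_congr rfl fun φ _ => ?_
    rw [← neg_smul]
    congr 1
    refine Eq.trans ?_ ((hr (φ 0) (φ 1) (φ 2) (φ 3) (φ 4)).trans ?_)
    · have (ψ : Fin 5 → ι) {a b c d k : ι} (ha : ψ 0 = a) (hb : ψ 1 = b) (hc : ψ 2 = c)
          (hd : ψ 3 = d) (hk : ψ 4 = k) : r ψ = r ![a, b, c, d, k] := by
        rw [e ψ, ha, hb, hc, hd, hk]
      simp only [List.map_cons, List.map_nil, List.sum_cons, List.sum_nil, add_zero, ← add_assoc]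
      repeat' refine congrArg₂ HAdd.hAdd ?_ ?_
      all_goals exact this _ rfl rfl rfl rfl rfl
    · simp [Equiv.swap_apply_def]
  have h₄ : ∑ φ : Fin 5 → ι, P (φ 0) (φ 1) (φ 2) (φ 3) (φ 4) •
        (x (φ 0) * x (φ 1) * x (φ 2) * x (φ 3) * x (φ 4) -
        x (φ 0) * x (φ 1) * x (φ 2) * (x (φ 3) * x (φ 4))) = 0 := by
    obtain ⟨W, hW⟩ : ∃ W : (Fin 5 → ι) → A, ∀ φ, W φ =
        x (φ 0) * x (φ 1) * x (φ 2) * x (φ 3) * x (φ 4) -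
          x (φ 0) * x (φ 1) * x (φ 2) * (x (φ 3) * x (φ 4)) := ⟨_, fun _ => rfl⟩
    have h₇ : ∀ φ, W (φ ∘ Equiv.swap 0 1) = W φ := fun φ => by
      simp [hW, hcomm (x (φ 1)), Equiv.swap_apply_def]
    have h₈ := sum_associator_eq_zero h x T hT₁ hT₂
    have h₉ : ∀ φ, associator (associator (x (φ 1)) (x (φ 0)) (x (φ 2))) (x (φ 3)) (x (φ 4)) =
        W φ - W (φ ∘ Equiv.swap 1 2) := fun φ => by
      simp [hW, associator, hcomm (x (φ 1)) (x (φ 0)), hcomm (x (φ 1)) (x (φ 0) * x (φ 2)),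
        Equiv.swap_apply_def, sub_mul]
      abel
    simp only [h₉, smul_sub, Finset.sum_sub_distrib] at h₈
    have h₅ : ∑ φ : Fin 5 → ι, T (φ 1) (φ 0) (φ 2) (φ 3) (φ 4) • W φ =
        ∑ φ : Fin 5 → ι, T (φ 0) (φ 1) (φ 2) (φ 3) (φ 4) • W φ := by
      rw [← sum_smul_perm (Equiv.swap 0 1)]
      exact Finset.sum_congr rfl fun φ _ => congrArg₂ _ rfl (h₇ φ)
    have h₆ : ∑ φ : Fin 5 → ι, T (φ 0) (φ 1) (φ 2) (φ 3) (φ 4) • W (φ ∘ Equiv.swap 1 2) =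
        -∑ φ : Fin 5 → ι, T (φ 0) (φ 1) (φ 2) (φ 3) (φ 4) • W φ := by
      rw [← sum_smul_perm (Equiv.swap 1 2), ← Finset.sum_neg_distrib]
      refine Finset.sum_congr rfl fun φ _ => ?_
      have h₀ : (φ ∘ Equiv.swap 1 2) ∘ Equiv.swap 1 2 = φ := funext fun i => by simp
      rw [h₀, ← neg_smul]
      exact congrArg (· • W φ) (hT₀ _ _ _ _ _)
    simp only [← hW, hP, add_smul, Finset.sum_add_distrib, h₅]
    rwa [h₆, sub_neg_eq_add] at h₈
  simp only [smul_sub, Finset.sum_sub_distrib, sub_eq_zero] at h₄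
  rw [h₂, add_zero]
  refine (smul_eq_zero.1 ?_).resolve_left (by norm_num : (4 : F) ≠ 0)
  rw [smul_add, h₃, ← h₄, ← h₁]
  module

end ThreeAssociators

/-! ### Transfer of identities from an algebra with a frame to the relatively free algebra. -/

section Transfer

variable {F ι A B : Type*} [Field F] [NonUnitalNonAssocRing B] [Module F B]
  [NonUnitalNonAssocRing A] [Module F A]

/-- The value of the part of a linear combination of the monomials `sh k` having a given sequence of
labels, when the values of the variables depend on their positions. -/
def labelledSum {κ : Type*} [Fintype κ] {n : ℕ} (sh : κ → FreeMagma (Fin n))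
    (c : κ × (Fin n → ι) → F) (ψ : Fin n → ι × B) : B :=
  ∑ k, c (k, fun l => (ψ l).1) • shapeEval (sh k) fun l => (ψ l).2

theorem sum_perm_labelledSum [Fintype ι] [DecidableEq ι] {κ : Type*} [Fintype κ] {n : ℕ}
    {sh : κ → FreeMagma (Fin n)}
    (hsh : ∃ μ : κ → MultilinearMap F (fun _ : Fin n => B) B, ∀ k x, μ k x = shapeEval (sh k) x)
    {c : κ × (Fin n → ι) → F}
    (h : ∀ y : ι → B, ∑ q, c q • shapeEval (sh q.1) (fun i => y (q.2 i)) = 0)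
    (z : Fin n → ι × B) :
    ∑ σ : Equiv.Perm (Fin n), labelledSum sh c (fun l => z (σ l)) = 0 := by
  obtain ⟨μ, hμ⟩ := hsh
  simp only [labelledSum, ← hμ] at h ⊢
  exact polarize μ c h (fun i => (z i).1) fun i => (z i).2

theorem labelledSum_shape₁ (c : Unit × (Fin 1 → ι) → F) (a : ι × B) :
    labelledSum shape₁ c ![a] = c ((), ![a.1]) • a.2 := by
  have h : (fun l => (![a] l).1) = ![a.1] := by
    ext i; fin_cases i; rfl
  rw [← h]
  simp [labelledSum, shape₁, shapeEval]

theorem labelledSum_shape₂ (c : Unit × (Fin 2 → ι) → F) (a b : ι × B) :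
    labelledSum shape₂ c ![a, b] = c ((), ![a.1, b.1]) • (a.2 * b.2) := by
  have h : (fun l => (![a, b] l).1) = ![a.1, b.1] := by
    ext i; fin_cases i <;> rfl
  simp [labelledSum, shape₂, shapeEval, h]

theorem labelledSum_shape₃ (c : Unit × (Fin 3 → ι) → F) (x y z : ι × B) :
    labelledSum shape₃ c ![x, y, z] = c ((), ![x.1, y.1, z.1]) • (x.2 * y.2 * z.2) := by
  have h : (fun l => (![x, y, z] l).1) = ![x.1, y.1, z.1] := by
    ext i; fin_cases i <;> rfl
  simp [labelledSum, shape₃, shapeEval, h]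

theorem labelledSum_shape₄ (c : Fin 2 × (Fin 4 → ι) → F) (x y z t : ι × B) :
    labelledSum shape₄ c ![x, y, z, t] =
      c (0, ![x.1, y.1, z.1, t.1]) • (x.2 * y.2 * z.2 * t.2) +
      c (1, ![x.1, y.1, z.1, t.1]) • (x.2 * y.2 * (z.2 * t.2)) := by
  have h : (fun l => (![x, y, z, t] l).1) = ![x.1, y.1, z.1, t.1] := by
    ext i; fin_cases i <;> rfl
  simp [labelledSum, shape₄, shapeEval, h]

theorem labelledSum_shape₅ (c : Fin 3 × (Fin 5 → ι) → F) (x y z t u : ι × B) :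
    labelledSum shape₅ c ![x, y, z, t, u] =
      c (0, ![x.1, y.1, z.1, t.1, u.1]) • (x.2 * y.2 * z.2 * t.2 * u.2) +
      c (1, ![x.1, y.1, z.1, t.1, u.1]) • (x.2 * y.2 * (z.2 * t.2) * u.2) +
      c (2, ![x.1, y.1, z.1, t.1, u.1]) • (x.2 * y.2 * z.2 * (t.2 * u.2)) := by
  have h : (fun l => (![x, y, z, t, u] l).1) = ![x.1, y.1, z.1, t.1, u.1] := by
    ext i; fin_cases i <;> rfl
  simp [labelledSum, Fin.sum_univ_three, shape₅, shapeEval, h]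

theorem symmPairs_swap (q : ι → ι → ι → ι → F) (a b c d : ι) :
    symmPairs q a b c d = symmPairs q c d a b := by
  simp only [symmPairs]; ring

theorem symmPairs_comm (q : ι → ι → ι → ι → F) (a b c d : ι) :
    symmPairs q a b c d = symmPairs q b a c d := by
  simp only [symmPairs]; ring

variable {γ n m : F} {o w e f : B} [Fintype ι] [DecidableEq ι]

theorem sum_shape₁_transfer (h : SpinFrame F γ n m o w e f) {c : Unit × (Fin 1 → ι) → F}
    (hc : ∀ y : ι → B, ∑ q, c q • shapeEval (shape₁ q.1) (fun i => y (q.2 i)) = 0)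
    (x : ι → A) : ∑ q, c q • shapeEval (shape₁ q.1) (fun i => x (q.2 i)) = 0 := by
  have h₀ : ∀ i, c ((), ![i]) = 0 := fun i => h.coeff₁_eq_zero fun y => by
    have := sum_perm_labelledSum (exists_multilinear_shape₁ F B) hc ![(i, y)]
    rwa [Fintype.sum_unique, show (fun l : Fin 1 => ![(i, y)] ((default : Equiv.Perm (Fin 1)) l)) =
      ![(i, y)] from rfl, labelledSum_shape₁] at this
  refine Finset.sum_eq_zero fun q _ => ?_
  rw [show q = ((), ![q.2 0]) from Prod.ext rfl (by ext i; fin_cases i; rfl), h₀, zero_smul]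

variable [IsScalarTower F B B] [SMulCommClass F B B] [CharZero F]

theorem sum_shape₂_transfer (h : SpinFrame F γ n m o w e f) (hcomm : ∀ x y : A, x * y = y * x)
    {c : Unit × (Fin 2 → ι) → F}
    (hc : ∀ y : ι → B, ∑ q, c q • shapeEval (shape₂ q.1) (fun i => y (q.2 i)) = 0)
    (x : ι → A) : ∑ q, c q • shapeEval (shape₂ q.1) (fun i => x (q.2 i)) = 0 := by
  rw [Fintype.sum_prod_type, Fintype.sum_unique]
  refine sum_shape₂_eq_zero hcomm x (fun φ => c ((), φ)) fun i j => h.coeff₁_eq_zero fun y => ?_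
  -- The unit in one argument reduces degree two to degree one.
  have := sum_perm_labelledSum (exists_multilinear_shape₂ F B) hc ![(i, o), (j, y)]
  simp only [sum_perm_two, labelledSum_shape₂] at this
  rwa [permSum₂_shape h.mul_comm fun a b => c ((), ![a, b]), h.one_mul] at this

theorem sum_shape₃_transfer (h : SpinFrame F γ n m o w e f) (hγ : γ ≠ 0)
    (hcomm : ∀ x y : A, x * y = y * x) {c : Unit × (Fin 3 → ι) → F}
    (hc : ∀ y : ι → B, ∑ q, c q • shapeEval (shape₃ q.1) (fun i => y (q.2 i)) = 0)
    (x : ι → A) : ∑ q, c q • shapeEval (shape₃ q.1) (fun i => x (q.2 i)) = 0 := by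
  rw [Fintype.sum_prod_type, Fintype.sum_unique]
  refine sum_shape₃_eq_zero hcomm x (fun φ => c ((), φ)) <| h.coeff₃_eq_zero hγ
    (p := fun a b d => c ((), ![a, b, d]) + c ((), ![b, a, d])) fun i j k y z t => ?_
  have := sum_perm_labelledSum (exists_multilinear_shape₃ F B) hc ![(i, y), (j, z), (k, t)]
  simp only [sum_perm_three, labelledSum_shape₃] at this
  rwa [permSum₃_shape h.mul_comm fun a b d => c ((), ![a, b, d])] at this

theorem sum_shape₄_transfer (h : SpinFrame F γ n m o w e f) (hγ : γ ≠ 0) (hγ' : 2 + 9 * γ ≠ 0)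
    (hcomm : ∀ x y : A, x * y = y * x) {c : Fin 2 × (Fin 4 → ι) → F}
    (hc : ∀ y : ι → B, ∑ q, c q • shapeEval (shape₄ q.1) (fun i => y (q.2 i)) = 0)
    (x : ι → A) : ∑ q, c q • shapeEval (shape₄ q.1) (fun i => x (q.2 i)) = 0 := by
  rw [Fintype.sum_prod_type, Fin.sum_univ_two]
  obtain ⟨hp, hq⟩ := h.coeff₄_eq_zero hγ hγ'
    (p := fun i j k l => c (0, ![i, j, k, l]) + c (0, ![j, i, k, l]))
    (q := symmPairs fun i j k l => c (1, ![i, j, k, l]))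
    (fun _ _ _ _ => add_comm _ _) (symmPairs_swap _) fun i j k l y z t u => by
      have := sum_perm_labelledSum (exists_multilinear_shape₄ F B) hc
        ![(i, y), (j, z), (k, t), (l, u)]
      simp only [sum_perm_four, labelledSum_shape₄] at this
      rwa [permSum₄_shape h.mul_comm (fun i j k l => c (0, ![i, j, k, l]))
        fun i j k l => c (1, ![i, j, k, l])] at this
  exact sum_shape₄_eq_zero hcomm x (fun φ => c (0, φ)) (fun φ => c (1, φ)) hp hq

theorem sum_shape₅_transfer (h : SpinFrame F γ n m o w e f) (hγ : γ ≠ 0) (hγ' : 2 + 9 * γ ≠ 0)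
    (hcomm : ∀ x y : A, x * y = y * x) (hA : ∀ a b c d : A, threeAssociatorsExpr a b c d = 0)
    {c : Fin 3 × (Fin 5 → ι) → F}
    (hc : ∀ y : ι → B, ∑ q, c q • shapeEval (shape₅ q.1) (fun i => y (q.2 i)) = 0)
    (x : ι → A) : ∑ q, c q • shapeEval (shape₅ q.1) (fun i => x (q.2 i)) = 0 := by
  rw [Fintype.sum_prod_type, Fin.sum_univ_three]
  have hE := h.coeffEquations hγ hγ'
    (p := fun i j k l s => c (0, ![i, j, k, l, s]) + c (0, ![j, i, k, l, s]))
    (q := fun i j k l s => symmPairs (fun i j k l => c (1, ![i, j, k, l, s])) i j k l)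
    (r := fun i j k l s => c (2, ![i, j, k, l, s]) + c (2, ![j, i, k, l, s]) +
      c (2, ![i, j, k, s, l]) + c (2, ![j, i, k, s, l]))
    (fun _ _ _ _ _ => add_comm _ _) (fun _ _ _ _ _ => symmPairs_comm _ _ _ _ _)
    (fun _ _ _ _ _ => symmPairs_swap _ _ _ _ _) (fun _ _ _ _ _ => by ring)
    (fun _ _ _ _ _ => by ring) fun i j k l s y z t u v => by
      have := sum_perm_labelledSum (exists_multilinear_shape₅ F B) hc
        ![(i, y), (j, z), (k, t), (l, u), (s, v)]
      simp only [sum_perm_five, labelledSum_shape₅] at this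
      rwa [permSum₅_shape h.mul_comm (fun i j k l s => c (0, ![i, j, k, l, s]))
        (fun i j k l s => c (1, ![i, j, k, l, s]))
        fun i j k l s => c (2, ![i, j, k, l, s])] at this
  obtain ⟨T, hT, hT₀, hT₁, hT₂⟩ := hE.exists_alternating hγ hγ'
  exact sum_shape₅_eq_zero hcomm hA x (fun φ => c (0, φ)) (fun φ => c (1, φ)) (fun φ => c (2, φ))
    (fun _ _ _ _ _ => rfl) (hE.q_eq_zero hγ hγ') (hE.r_eq hγ hγ') hT hT₀ hT₁ hT₂

end Transfer

/-! ### The frame 1, w, e, f inside S(α,E). -/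

section SplitSpin

open LinearMap (BilinForm)

variable {F E : Type*} [Field F] [CharZero F] [AddCommGroup E] [Module F E]

/-- Gram–Schmidt: if ⟨u,v⟩ ≠ 0, one of u, v, u + v is anisotropic. This gives `e`, and applied again
to vectors projected to the complement of `e` it gives `f`. -/
theorem exists_orthogonal_pair {B : BilinForm F E} (hsymm : B.IsSymm)
    (hnondeg : B.Nondegenerate) (hdim : 2 ≤ Module.rank F E) :
    ∃ e f : E, B e e ≠ 0 ∧ B f f ≠ 0 ∧ B e f = 0 := by
  have h2 : (2 : F) ≠ 0 := two_ne_zero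
  have hself : ∀ u v : E, B u v ≠ 0 → B u u ≠ 0 ∨ B v v ≠ 0 ∨ B (u + v) (u + v) ≠ 0 := by
    intro u v huv
    by_contra! h
    obtain ⟨h₁, h₃, h₄⟩ := h
    simp only [map_add, LinearMap.add_apply, h₁, h₃, hsymm.eq v u, zero_add, add_zero] at h₄
    exact huv ((mul_eq_zero.1 (by linear_combination h₄ : 2 * B u v = 0)).resolve_left h2)
  have hex : ∀ u : E, u ≠ 0 → ∃ v, B u v ≠ 0 := fun u hu => by
    by_contra! h
    exact hu (hnondeg.1 u h)
  have hrank : ∀ e : E, ∃ v, ∀ r : F, r • e ≠ v := by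
    intro e
    by_contra! h
    exact absurd (hdim.trans (rank_le_one_iff.2 ⟨e, h⟩)) (by norm_num)
  obtain ⟨e, he⟩ : ∃ e, B e e ≠ 0 := by
    obtain ⟨u, hu⟩ := hrank 0
    obtain ⟨v, hv⟩ := hex u fun h => hu 0 (by rw [h, smul_zero])
    rcases hself u v hv with h | h | h <;> exact ⟨_, h⟩
  have hproj : ∀ v, B e (v - (B e v / B e e) • e) = 0 := fun v => by
    rw [map_sub, map_smul, smul_eq_mul, div_mul_cancel₀ _ he, sub_self]
  obtain ⟨v, hv⟩ := hrank e
  set u := v - (B e v / B e e) • e with hu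
  obtain ⟨w, hw⟩ := hex u fun h => hv _ (sub_eq_zero.1 h).symm
  have hu₀ : B e u = 0 := hproj v
  have hw' : B u (w - (B e w / B e e) • e) ≠ 0 := by
    rwa [map_sub, map_smul, hsymm.eq u e, hu₀, smul_zero, sub_zero]
  rcases hself _ _ hw' with h | h | h
  · exact ⟨e, _, he, h, hu₀⟩
  · exact ⟨e, _, he, h, hproj w⟩
  · exact ⟨e, _, he, h, by rw [map_add, hu₀, hproj, add_zero]⟩

/-- The element w is the combination of z₁, z₂ that kills E, scaled so that its coordinates add up
to 1; this makes w² - w a multiple of the unit. -/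
theorem exists_spinFrame {B : BilinForm F E} (hsymm : B.IsSymm)
    (hnondeg : B.Nondegenerate) (hdim : 2 ≤ Module.rank F E) {α : F}
    (hα : α ∉ ({-1, 0, 1 / 2, 1, 2} : Set F)) :
    ∃ (γ n m : F) (o w e f : SplitSpinFactor α B), SpinFrame F γ n m o w e f ∧ γ ≠ 0 ∧
      2 + 9 * γ ≠ 0 := by
  obtain ⟨e, f, he, hf, hef⟩ := exists_orthogonal_pair hsymm hnondeg hdim
  simp only [Set.mem_insert_iff, Set.mem_singleton_iff, not_or] at hα
  obtain ⟨h₁, h₂, h₃, h₄, h₅⟩ := hα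
  have hε : 1 - 2 * α ≠ 0 := fun h => h₃ (by linear_combination (-1 / 2) * h)
  have h₁' : 1 + α ≠ 0 := fun h => h₁ (by linear_combination h)
  have h₄' : 1 - α ≠ 0 := fun h => h₄ (by linear_combination -h)
  have h₅' : α - 2 ≠ 0 := fun h => h₅ (by linear_combination h)
  -- The condition 2 + 9γ ≠ 0 amounts to α ≠ -1, 2, as γ ≠ 0 amounts to α ≠ 0, 1.
  have hγ' : 2 + 9 * (α * (1 - α) / (1 - 2 * α) ^ 2) =
      -((α - 2) * (1 + α)) / (1 - 2 * α) ^ 2 := by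
    field_simp
    ring
  have hk : (1 - 2 * α) ^ 2 / (α * (α - 2)) ≠ 0 := by positivity
  have hδ : (1 - 2 * α) * (1 - 2 * α)⁻¹ = 1 := mul_inv_cancel₀ hε
  -- The prescribed value of t enters here: it is the ratio of the z₂- and z₁-coordinates of w - (1
  -- + 3γ), so squares of vectors are multiples of that element.
  have hc₁ : (1 - α) / (1 - 2 * α) - (1 + 3 * (α * (1 - α) / (1 - 2 * α) ^ 2)) =
      α * (α - 2) / (1 - 2 * α) ^ 2 := by
    simp only [div_eq_mul_inv, ← inv_pow]
    linear_combination (1 - α * (1 - 2 * α)⁻¹) * hδ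
  have hc₂ : -α / (1 - 2 * α) - (1 + 3 * (α * (1 - α) / (1 - 2 * α) ^ 2)) =
      (α ^ 2 - 1) / (1 - 2 * α) ^ 2 := by
    simp only [div_eq_mul_inv, ← inv_pow]
    linear_combination (1 + (1 - α) * (1 - 2 * α)⁻¹) * hδ
  have hcancel : ∀ b c d ε : F, ε ≠ 0 → b * (ε / d) * (c / ε) = c / d * b := fun b c d ε h => by
    field_simp
  have hw : α * ((1 - α) / (1 - 2 * α)) + (1 - α) * (-α / (1 - 2 * α)) = 0 := by ring
  have hsq : ∀ v : E, (⟨0, 0, v⟩ * ⟨0, 0, v⟩ : SplitSpinFactor α B) =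
      (B v v * ((1 - 2 * α) ^ 2 / (α * (α - 2)))) •
        (⟨(1 - α) / (1 - 2 * α), -α / (1 - 2 * α), 0⟩ -
          (1 + 3 * (α * (1 - α) / (1 - 2 * α) ^ 2)) • ⟨1, 1, 0⟩) := fun v => by
    ext
    · change 0 * 0 + B v v = (B v v * ((1 - 2 * α) ^ 2 / (α * (α - 2)))) *
        ((1 - α) / (1 - 2 * α) - (1 + 3 * (α * (1 - α) / (1 - 2 * α) ^ 2)) * 1)
      rw [mul_one, hc₁, hcancel _ _ _ _ (pow_ne_zero 2 hε), div_self (mul_ne_zero h₂ h₅'), one_mul,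
        mul_zero, zero_add]
    · change 0 * 0 + (α ^ 2 - 1) / (α * (α - 2)) * B v v =
        (B v v * ((1 - 2 * α) ^ 2 / (α * (α - 2)))) *
        (-α / (1 - 2 * α) - (1 + 3 * (α * (1 - α) / (1 - 2 * α) ^ 2)) * 1)
      rw [mul_one, hc₂, hcancel _ _ _ _ (pow_ne_zero 2 hε), mul_zero, zero_add]
    · change (α * 0 + (1 - α) * 0) • v + (α * 0 + (1 - α) * 0) • v =
        (B v v * ((1 - 2 * α) ^ 2 / (α * (α - 2)))) •
        ((0 : E) - (1 + 3 * (α * (1 - α) / (1 - 2 * α) ^ 2)) • (0 : E))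
      simp
  refine ⟨α * (1 - α) / (1 - 2 * α) ^ 2, B e e * ((1 - 2 * α) ^ 2 / (α * (α - 2))),
    B f f * ((1 - 2 * α) ^ 2 / (α * (α - 2))), ⟨1, 1, 0⟩,
    ⟨(1 - α) / (1 - 2 * α), -α / (1 - 2 * α), 0⟩, ⟨0, 0, e⟩, ⟨0, 0, f⟩, ?_, by positivity, ?_⟩
  · constructor
    · intro x y
      ext
      · simp [hsymm.eq y.vec x.vec, mul_comm]
      · simp [hsymm.eq y.vec x.vec, mul_comm]
      · simp [add_comm]
    · intro x
      ext <;> simp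
    · ext
      · simp; field_simp; ring
      · simp; field_simp; ring
      · simp
    · ext
      · simp
      · simp
      · simp [hw]
    · ext
      · simp
      · simp
      · simp [hw]
    · ext <;> simp [hef]
    · exact hsq e
    · exact hsq f
    · intro a b h
      have ha := congrArg SplitSpin.c₁ h
      have hb := congrArg SplitSpin.c₂ h
      simp only [SplitSpin.c₁_add, SplitSpin.c₁_smul, SplitSpin.c₁_zero, SplitSpin.c₂_add,
        SplitSpin.c₂_smul, SplitSpin.c₂_zero, smul_eq_mul, mul_one] at ha hb
      have hab : b * (1 / (1 - 2 * α)) = 0 := by linear_combination ha - hb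
      have hb₀ : b = 0 := (mul_eq_zero.1 hab).resolve_right (one_div_ne_zero hε)
      exact ⟨by simpa [hb₀] using ha, hb₀⟩
    · intro h
      exact he (by simp [show e = 0 from congrArg SplitSpin.vec h])
    · intro h
      exact hf (by simp [show f = 0 from congrArg SplitSpin.vec h])
    · exact mul_ne_zero he hk
    · exact mul_ne_zero hf hk
  · rw [hγ']
    exact div_ne_zero (neg_ne_zero.2 (mul_ne_zero h₅' h₁')) (pow_ne_zero _ hε)

end SplitSpin

/-! ### Membership in the T-ideal. -/

section Main

variable {F : Type*} [Field F]

/-- The normal form of `f` modulo commutativity vanishes on `A`, hence by `htransfer` on the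
relatively free algebra of `S`. At the generators its value there is the class of `f`. -/
theorem mem_tIdeal_of_transfer {S : Set (NAPoly F)} (hS : commutativity F ∈ S) {A : Type*}
    [NonUnitalNonAssocRing A] [Module F A] [IsScalarTower F A A] [SMulCommClass F A A]
    (hA : ∀ x y : A, x * y = y * x) {n : ℕ} {κ : Type*} [Fintype κ]
    (sh : κ → FreeMagma (Fin n))
    (hsh : ∀ (N : ℕ) (m : FreeMagma ℕ) (y : ℕ → RelFree {commutativity F}), m.length = n →
      varBound m ≤ N →
      ∃ (k : κ) (φ : Fin n → Fin N), FreeMagma.lift y m = shapeEval (sh k) fun i => y (φ i))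
    (htransfer : ∀ (N : ℕ) (c : κ × (Fin n → Fin N) → F),
      (∀ y : Fin N → A, ∑ q, c q • shapeEval (sh q.1) (fun i => y (q.2 i)) = 0) →
      ∀ x : Fin N → RelFree S, ∑ q, c q • shapeEval (sh q.1) (fun i => x (q.2 i)) = 0)
    {f : NAPoly F} (hf : ∀ m ∈ f.coeff.support, m.length = n) (hfA : IsIdentityOf f A) :
    f ∈ tIdeal S := by
  obtain ⟨N, hN⟩ : ∃ N, ∀ m ∈ f.coeff.support, varBound m ≤ N :=
    ⟨f.coeff.support.sup varBound, fun m hm => Finset.le_sup hm⟩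
  obtain ⟨c, hc⟩ := exists_mk_eq_sum (S := {commutativity F}) sh
    (fun m hm hmN => hsh N m _ hm hmN) hf hN
  have hc' := htransfer N c (fun y => by
    have := lift_eq_sum_of_mk_eq (A := A)
      (Set.singleton_subset_iff.2 (commutativity_mem_identities hA)) hc
      -- Variables of index at least `N` do not occur, so their value is immaterial.
      fun i => if h : i < N then y ⟨i, h⟩ else 0
    rw [hfA] at this
    simpa using this.symm) fun i => RelFree.mk S (var F i)
  rw [← RelFree.mk_eq_zero, ← hc']
  have := lift_eq_sum_of_mk_eq (A := RelFree S) (Set.singleton_subset_iff.2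
    (commutativity_mem_identities (RelFree.mul_comm_of_mem hS))) hc fun i => RelFree.mk S (var F i)
  rw [← this, RelFree.lift_mk]
  congr 1
  have h : FreeNonUnitalNonAssocAlgebra.lift F (var F) = NonUnitalAlgHom.id F (NAPoly F) :=
    FreeNonUnitalNonAssocAlgebra.hom_ext F fun i => by simp [var]
  rw [h]
  rfl

theorem mem_tIdeal_of_spinFrame [CharZero F] {A : Type*} [NonUnitalNonAssocRing A] [Module F A]
    [IsScalarTower F A A] [SMulCommClass F A A] {γ n m : F} {o w e e' : A}
    (h : SpinFrame F γ n m o w e e') (hγ : γ ≠ 0) (hγ' : 2 + 9 * γ ≠ 0) {f : NAPoly F}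
    (hdeg : DegreeLE f 5) (hf : IsIdentityOf f A) :
    f ∈ tIdeal {commutativity F, threeAssociators F} := by
  have hS : commutativity F ∈ ({commutativity F, threeAssociators F} : Set (NAPoly F)) :=
    Set.mem_insert _ _
  have hS' : threeAssociators F ∈ ({commutativity F, threeAssociators F} : Set (NAPoly F)) :=
    Set.mem_insert_of_mem _ (Set.mem_singleton _)
  have hcomm := RelFree.mul_comm_of_mem hS
  have hcomm₀ := RelFree.mul_comm_of_mem (Set.mem_singleton (commutativity F))
  have hassoc := RelFree.threeAssociators_of_mem hS'
  refine mem_of_homComp_mem hdeg fun k hk => ?_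
  have hk' := hf.homComp hdeg hk
  interval_cases k
  · have h₀ : homComp 0 f = 0 := by
      refine MonoidAlgebra.coeff_injective (Finsupp.support_eq_empty.1 ?_)
      exact Finset.eq_empty_of_forall_notMem fun m hm =>
        m.length_pos.ne' (mem_support_homComp hm)
    rw [h₀]
    exact zero_mem _
  · exact mem_tIdeal_of_transfer hS h.mul_comm shape₁
      (fun _ _ y => exists_shape₁ y)
      (fun _ _ hc => sum_shape₁_transfer h hc) (fun _ => mem_support_homComp) hk'
  · exact mem_tIdeal_of_transfer hS h.mul_comm shape₂
      (fun _ _ y => exists_shape₂ y)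
      (fun _ _ hc => sum_shape₂_transfer h hcomm hc) (fun _ => mem_support_homComp) hk'
  · exact mem_tIdeal_of_transfer hS h.mul_comm shape₃
      (fun _ _ y => exists_shape₃ hcomm₀ y)
      (fun _ _ hc => sum_shape₃_transfer h hγ hcomm hc) (fun _ => mem_support_homComp) hk'
  · exact mem_tIdeal_of_transfer hS h.mul_comm shape₄
      (fun _ _ y => exists_shape₄ hcomm₀ y)
      (fun _ _ hc => sum_shape₄_transfer h hγ hγ' hcomm hc) (fun _ => mem_support_homComp) hk'
  · exact mem_tIdeal_of_transfer hS h.mul_comm shape₅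
      (fun _ _ y => exists_shape₅ hcomm₀ y)
      (fun _ _ hc => sum_shape₅_transfer h hγ hγ' hcomm hassoc hc)
      (fun _ => mem_support_homComp) hk'

end Main

end PolyIdentity

theorem theorem4 {F E : Type*} [Field F] [CharZero F] [AddCommGroup E] [Module F E]
    (B : LinearMap.BilinForm F E) (hsymm : B.IsSymm) (hnondeg : B.Nondegenerate)
    (hdim : 2 ≤ Module.rank F E)
    (α : F) (hα : α ∉ ({-1, 0, 1 / 2, 1, 2} : Set F))
    (f : PolyIdentity.NAPoly F) (hdeg : PolyIdentity.DegreeLE f 5)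
    (hf : PolyIdentity.IsIdentityOf f (SplitSpinFactor α B)) :
    PolyIdentity.IsConsequenceOf f
      {PolyIdentity.commutativity F, PolyIdentity.threeAssociators F} := by
  obtain ⟨γ, n, m, o, w, e, e', h, hγ, hγ'⟩ :=
    PolyIdentity.exists_spinFrame hsymm hnondeg hdim hα
  exact PolyIdentity.mem_tIdeal_of_spinFrame h hγ hγ' hdeg hf
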